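/- Let $(X_i)_{i\in\mathbb Z}$ be a strictly stationary sequence of random variables on a probability space $(\Omega,\mathcal F,\mathbb P)$ with values in a separable metric space $(S,d)$, let $\mathbb H$ be a separable Hilbert space and let $h\colon S\times S\to\mathbb H$ be measurable, where $S\times S$ carries the product $\sigma$-algebra and $\mathbb H$ its Borel $\sigma$-algebra. Let $X_1'$ be an independent copy of $X_1$. For $\sigma$-algebras $\mathcal A,\mathcal B\subset\mathcal F$ put $$\beta(\mathcal A,\mathcal B)=\frac12\sup\sum_{i=1}^I\sum_{j=1}^J\bigl|\mathbb P(A_i\cap B_j)-\mathbb P(A_i)\mathbb P(B_j)\bigr|,$$ the supremum being over all finite partitions $(A_i)_{i=1}^I$ and $(B_j)_{j=1}^J$ of $\Omega$ into elements of $\mathcal A$ and $\mathcal B$ respectively, and for $k\ge1$ put $$\beta(k)=\sup_{\ell\ge1}\beta\bigl(\sigma(X_i,\,1\le i\le\ell),\ \sigma(X_i,\,i\ge\ell+k)\bigr).$$ Let $1<p<2$ and $\delta>0$ with $p+\delta<2$. Suppose that the following conditions hold. 1. Degeneracy: $\mathbb E[h(X_1,X_1')\mid X_1]=\mathbb E[h(X_1,X_1')\mid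 X_1']=0$ almost surely. 2. Moment condition: $\mathbb E\bigl[\|h(X_1,X_1')\|_{\mathbb H}^{p+\delta}\bigr]<\infty$. 3. Boundedness in $\mathbb L^1$: $\sup_{j\ge2}\mathbb E\bigl[\|h(X_1,X_j)\|_{\mathbb H}\bigr]<\infty$. 4. Mixing condition: $\displaystyle\sum_{k=1}^\infty k^{\,p-1+\frac{p(p-1)}{\delta}}\,\beta(k)<\infty$. Then, with $U_n(h)=\sum_{1\le i<j\le n}h(X_i,X_j)$, $$\lim_{n\to\infty}\frac1{n^{2/p}}\,\|U_n(h)\|_{\mathbb H}=0\qquad\text{almost surely.}$$ -/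

import Mathlib

open MeasureTheory ProbabilityTheory Filter Topology
open scoped ENNReal

namespace MixingUStat

section

variable {Ω S H : Type*}

/-- `A 0, …, A (I - 1)` is a finite partition of `Ω` into elements of the `σ`-algebra `m`. -/
structure IsPartition (m : MeasurableSpace Ω) {I : ℕ} (A : Fin I → Set Ω) : Prop where
  measurableSet : ∀ i, MeasurableSet[m] (A i)
  pairwise_disjoint : Pairwise fun i j => Disjoint (A i) (A j)
  iUnion_eq : ⋃ i, A i = Set.univ

/-- The coefficient `β(m₁, m₂)`: one half of the supremum, over all finite partitions `A` of `Ω`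
into elements of `m₁` and `B` into elements of `m₂`, of `∑ i, ∑ j, |P(A i ∩ B j) - P(A i) P(B j)|`.
The supremum is taken in `[0, ∞]`, where it always exists. -/
noncomputable def betaCoeff {m₀ : MeasurableSpace Ω} (P : Measure Ω)
    (m₁ m₂ : MeasurableSpace Ω) : ℝ≥0∞ :=
  (1 / 2) * ⨆ (I : ℕ) (J : ℕ) (A : Fin I → Set Ω) (B : Fin J → Set Ω)
    (_ : IsPartition m₁ A) (_ : IsPartition m₂ B),
    ∑ i, ∑ j, ENNReal.ofReal |P.real (A i ∩ B j) - P.real (A i) * P.real (B j)|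

/-- The `σ`-algebra generated by the random variables `X i`, `i ∈ s`. -/
@[reducible] def sigmaGen [MeasurableSpace S] (X : ℤ → Ω → S) (s : Set ℤ) : MeasurableSpace Ω :=
  ⨆ i ∈ s, MeasurableSpace.comap (X i) inferInstance

/-- The mixing coefficients of a sequence:
`β(k) = sup_{ℓ ≥ 1} β(σ(X_1, …, X_ℓ), σ(X_i, i ≥ ℓ + k))`. -/
noncomputable def beta {m₀ : MeasurableSpace Ω} [MeasurableSpace S] (P : Measure Ω)
    (X : ℤ → Ω → S) (k : ℕ) : ℝ≥0∞ :=
  ⨆ (l : ℤ) (_ : 1 ≤ l),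
    betaCoeff P (sigmaGen X (Set.Icc 1 l)) (sigmaGen X (Set.Ici (l + (k : ℤ))))

/-- Strict stationarity: every shift of the process has the same law as the process, on the product
`σ`-algebra of `ℤ → S`. -/
def StrictlyStationary {m₀ : MeasurableSpace Ω} [MeasurableSpace S] (P : Measure Ω)
    (X : ℤ → Ω → S) : Prop :=
  ∀ k : ℤ, IdentDistrib (fun ω i => X (i + k) ω) (fun ω i => X i ω) P P

/-- The `U`-statistic of order two `U_n(h) = ∑_{1 ≤ i < j ≤ n} h(X_i, X_j)`. -/
noncomputable def uStat [AddCommMonoid H] (h : S × S → H) (X : ℤ → Ω → S) (n : ℕ) (ω : Ω) : H :=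
  ∑ ij ∈ (Finset.Icc (1 : ℤ) n ×ˢ Finset.Icc (1 : ℤ) n) with ij.1 < ij.2,
    h (X ij.1 ω, X ij.2 ω)

/-- `h(Y, Y')`, where `Y' = Y ∘ snd` is an independent copy of `Y = Y ∘ fst` on the product space
`(Ω × Ω, P ⊗ P)`. -/
def copyPair (h : S × S → H) (Y : Ω → S) (w : Ω × Ω) : H :=
  h (Y w.1, Y w.2)

/-- Degeneracy of the kernel `h` for the law of `Y`:
`E[h(Y, Y') | Y] = E[h(Y, Y') | Y'] = 0` almost surely, with `Y'` an independent copy of `Y`. -/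
def IsDegenerate {m₀ : MeasurableSpace Ω} [MeasurableSpace S] [NormedAddCommGroup H]
    [NormedSpace ℝ H] [CompleteSpace H] (P : Measure Ω) (h : S × S → H) (Y : Ω → S) : Prop :=
  (P.prod P)[copyPair h Y | MeasurableSpace.comap (fun w : Ω × Ω => Y w.1) inferInstance]
      =ᵐ[P.prod P] 0 ∧
    (P.prod P)[copyPair h Y | MeasurableSpace.comap (fun w : Ω × Ω => Y w.2) inferInstance]
      =ᵐ[P.prod P] 0

end

end MixingUStat

/-!
The sum over pairs `i < j ≤ n` is split into blocks of a length `q` much smaller than `n`. Pairs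
with `j - i` or `i` of order `q` number `O(n q)` and are estimated in `L¹`
(`lintegral_nearPairs_le`).

For the other pairs, cut the integers into intervals of length `q` and group these modulo four. Two
given indices avoid one of the first three classes, so both lie in the same system of blocks of
length `3 q` separated by gaps of length `q`, one of three such systems (`enorm_uStat_le`). By
`β`-mixing, the law of `m` separated blocks is within `2 m β(q)` in total variation of the product
of the laws of the blocks (`map_pi_apply_le`); no coupling is needed.

Under the product law, a pair of positions `s`, `s'` in the blocks yields the sum
`∑_{k < l} h(x_k(s), x_l(s'))`, whose terms are centred in `x_k` and in `x_l` by degeneracy. From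
`E‖x + Y‖ ^ r ≤ ‖x‖ ^ r + 2 E‖Y‖ ^ r` for centred `Y` in a Hilbert space and `1 ≤ r ≤ 2`
(`lintegral_enorm_add_rpow_le`), the increments in the range of `l` have `r`-th moments at most
`4 m E‖h‖ ^ r` per step (`lintegral_pi_blockSum_sub_le`), and dyadic chaining bounds the maximum
(`lintegral_iSup_rpow_le_of_increments`). Minkowski's inequality over the `9 q ^ 2` pairs of
positions then costs the factor `q ^ (2 r)`, and no mixing inside the blocks is used.

With `r = p + δ`, `n = 2 ^ N`, `q` about `n ^ a` and `m` about `n / q`, the mixing rate makes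
`m β(q)` summable over `N` if `a (2 + γ) > 1`, where `γ = p - 1 + p (p - 1) / δ`, and the moment
term is summable if `a < δ / (p (r - 1))`. These two conditions are compatible
(`exists_exponents`), and the second one also takes care of the pairs estimated in `L¹`. The
Borel–Cantelli lemma concludes.
-/

namespace MixingUStat

/-! ### Centred summands in Hilbert space -/

/-- A Clarkson type inequality for exponents at most `2`: by the parallelogram law and concavity of
`u ↦ u ^ (r / 2)`. It gives Hilbert spaces martingale type `r` without any martingale machinery. -/
theorem enorm_add_rpow_add_enorm_sub_rpow_le {H : Type*} [NormedAddCommGroup H]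
    [InnerProductSpace ℝ H] {r : ℝ} (hr0 : 0 < r) (hr2 : r ≤ 2) (x y : H) :
    ‖x + y‖ₑ ^ r + ‖x - y‖ₑ ^ r ≤ 2 * (‖x‖ₑ ^ r + ‖y‖ₑ ^ r) := by
  have hs0 : 0 ≤ r / 2 := by positivity
  have hs1 : r / 2 ≤ 1 := by linarith
  have key : ∀ z : H, ‖z‖₊ ^ r = (‖z‖₊ ^ 2) ^ (r / 2) := fun z => by
    rw [← NNReal.rpow_natCast, ← NNReal.rpow_mul]; congr 1; push_cast; ring
  have hpar : ‖x + y‖₊ ^ 2 + ‖x - y‖₊ ^ 2 = 2 * (‖x‖₊ ^ 2 + ‖y‖₊ ^ 2) := by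
    apply NNReal.eq
    push_cast
    have := parallelogram_law_with_norm ℝ x y
    nlinarith
  have hmean : ∀ u v : NNReal, u ^ (r / 2) + v ^ (r / 2) ≤ 2 * ((u + v) / 2) ^ (r / 2) := by
    intro u v
    have h := (NNReal.concaveOn_rpow hs0 hs1).2 (Set.mem_univ u) (Set.mem_univ v)
      (show (0 : NNReal) ≤ 1 / 2 by positivity) (show (0 : NNReal) ≤ 1 / 2 by positivity)
      (add_halves 1)
    simp only [smul_eq_mul] at h
    have e : (1 / 2 * u + 1 / 2 * v : NNReal) = (u + v) / 2 := by
      rw [add_div]; ring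
    rw [e] at h
    calc u ^ (r / 2) + v ^ (r / 2) = 2 * (1 / 2 * u ^ (r / 2) + 1 / 2 * v ^ (r / 2)) := by
          rw [mul_add, ← mul_assoc, ← mul_assoc]; simp
      _ ≤ _ := by gcongr
  have main : ‖x + y‖₊ ^ r + ‖x - y‖₊ ^ r ≤ 2 * (‖x‖₊ ^ r + ‖y‖₊ ^ r) := by
    rw [key, key, key x, key y]
    refine (hmean _ _).trans ?_
    rw [hpar, mul_div_cancel_left₀ _ two_ne_zero]
    gcongr
    exact NNReal.rpow_add_le_add_rpow _ _ hs0 hs1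
  simp only [enorm_eq_nnnorm]
  simp only [← ENNReal.coe_rpow_of_nonneg _ hr0.le]
  exact_mod_cast main

theorem integrable_of_lintegral_rpow_lt_top {α H : Type*} [MeasurableSpace α] {μ : Measure α}
    [IsProbabilityMeasure μ] [NormedAddCommGroup H] {f : α → H} (hf : AEStronglyMeasurable f μ)
    {r : ℝ} (hr1 : 1 ≤ r) (hfin : ∫⁻ z, ‖f z‖ₑ ^ r ∂μ < ∞) : Integrable f μ := by
  have hr0 : 0 < r := by linarith
  have hmem : MemLp f (ENNReal.ofReal r) μ := by
    refine ⟨hf, ?_⟩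
    rw [eLpNorm_lt_top_iff_lintegral_rpow_enorm_lt_top (by simpa using hr0) (by simp),
      ENNReal.toReal_ofReal hr0.le]
    exact hfin
  exact hmem.integrable (by simpa using hr1)

/-- Adding a centred random vector `g` to a constant `x` increases the `r`-th moment by at most
`2 E‖g‖ ^ r`: integrate `enorm_add_rpow_add_enorm_sub_rpow_le` and cancel `‖x‖ ^ r`, which is at
most `E‖x - g‖ ^ r` by Jensen's inequality. -/
theorem lintegral_enorm_add_rpow_le {α H : Type*} [MeasurableSpace α] [NormedAddCommGroup H]
    [InnerProductSpace ℝ H] [CompleteSpace H] (ν : Measure α) [IsProbabilityMeasure ν] {r : ℝ}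
    (hr1 : 1 ≤ r) (hr2 : r ≤ 2) (x : H) {g : α → H} (hg : AEStronglyMeasurable g ν)
    (hg0 : ∫ y, g y ∂ν = 0) :
    ∫⁻ y, ‖x + g y‖ₑ ^ r ∂ν ≤ ‖x‖ₑ ^ r + 2 * ∫⁻ y, ‖g y‖ₑ ^ r ∂ν := by
  have hr0 : 0 < r := by linarith
  by_cases hfin : ∫⁻ y, ‖g y‖ₑ ^ r ∂ν = ∞
  · simp [hfin]
  have hint : Integrable g ν :=
    integrable_of_lintegral_rpow_lt_top hg hr1 (lt_top_iff_ne_top.2 hfin)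
  have hjen : ‖x‖ₑ ^ r ≤ ∫⁻ y, ‖x - g y‖ₑ ^ r ∂ν := by
    have h1 : ‖x‖ₑ ≤ ∫⁻ y, ‖x - g y‖ₑ ∂ν := by
      have : ∫ y, (x - g y) ∂ν = x := by
        rw [integral_sub (integrable_const _) hint, hg0]; simp
      calc ‖x‖ₑ = ‖∫ y, (x - g y) ∂ν‖ₑ := by rw [this]
        _ ≤ _ := enorm_integral_le_lintegral_enorm _
    have h2 := eLpNorm_le_eLpNorm_of_exponent_le (μ := ν) (p := 1) (q := ENNReal.ofReal r)
      (by simpa using hr1) ((aestronglyMeasurable_const (b := x)).sub hg)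
    rw [eLpNorm_one_eq_lintegral_enorm,
      eLpNorm_eq_lintegral_rpow_enorm_toReal (by simpa using hr0) (by simp),
      ENNReal.toReal_ofReal hr0.le, one_div] at h2
    exact (ENNReal.le_rpow_inv_iff hr0).1 (h1.trans h2)
  have hsum : ∫⁻ y, ‖x + g y‖ₑ ^ r ∂ν + ∫⁻ y, ‖x - g y‖ₑ ^ r ∂ν
      ≤ 2 * ‖x‖ₑ ^ r + 2 * ∫⁻ y, ‖g y‖ₑ ^ r ∂ν := by
    calc _ ≤ ∫⁻ y, (‖x + g y‖ₑ ^ r + ‖x - g y‖ₑ ^ r) ∂ν := le_lintegral_add _ _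
      _ ≤ ∫⁻ y, 2 * (‖x‖ₑ ^ r + ‖g y‖ₑ ^ r) ∂ν :=
          lintegral_mono fun y => enorm_add_rpow_add_enorm_sub_rpow_le hr0 hr2 x (g y)
      _ = _ := by
          rw [lintegral_const_mul' _ _ (by simp), lintegral_add_left measurable_const]
          simp [mul_add]
  have hx : ‖x‖ₑ ^ r ≠ ∞ := ENNReal.rpow_ne_top_of_nonneg hr0.le enorm_ne_top
  refine (ENNReal.add_le_add_iff_right hx).1 ?_
  calc _ ≤ _ := by gcongr
    _ ≤ _ := hsum
    _ = _ := by ring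

/-- Integrating one coordinate of a product measure first. -/
theorem lintegral_pi_eq_lintegral_update {ι : Type*} [Fintype ι] [DecidableEq ι] {α : ι → Type*}
    [∀ i, MeasurableSpace (α i)] (ν : ∀ i, Measure (α i)) [∀ i, IsProbabilityMeasure (ν i)]
    (i : ι) {f : (∀ i, α i) → ℝ≥0∞} (hf : Measurable f) :
    ∫⁻ x, f x ∂Measure.pi ν = ∫⁻ x, ∫⁻ y, f (Function.update x i y) ∂ν i ∂Measure.pi ν := by
  refine lintegral_eq_of_lmarginal_eq ({i} : Finset ι) hf ?_ ?_
  · have := hf.lmarginal ν (s := {i})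
    rwa [lmarginal_singleton] at this
  · rw [lmarginal_singleton, lmarginal_singleton]
    ext x
    simp

/-- The conditional form of `lintegral_enorm_add_rpow_le` on a product space: `G` is centred when
the coordinate `i` is integrated out, and `F` does not depend on that coordinate. -/
theorem lintegral_pi_enorm_add_rpow_le {ι : Type*} [Fintype ι] [DecidableEq ι] {α : ι → Type*}
    [∀ i, MeasurableSpace (α i)] (ν : ∀ i, Measure (α i)) [∀ i, IsProbabilityMeasure (ν i)]
    {H : Type*} [NormedAddCommGroup H] [InnerProductSpace ℝ H] [CompleteSpace H]
    [MeasurableSpace H] [BorelSpace H] [SecondCountableTopology H] {r : ℝ} (hr1 : 1 ≤ r)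
    (hr2 : r ≤ 2) (i : ι) {F G : (∀ i, α i) → H} (hF : Measurable F) (hG : Measurable G)
    (hFi : ∀ x y, F (Function.update x i y) = F x)
    (hGi : ∀ᵐ x ∂Measure.pi ν, ∫ y, G (Function.update x i y) ∂ν i = 0) :
    ∫⁻ x, ‖F x + G x‖ₑ ^ r ∂Measure.pi ν
      ≤ ∫⁻ x, ‖F x‖ₑ ^ r ∂Measure.pi ν + 2 * ∫⁻ x, ‖G x‖ₑ ^ r ∂Measure.pi ν := by
  rw [lintegral_pi_eq_lintegral_update ν i (f := fun x => ‖F x + G x‖ₑ ^ r) (by fun_prop),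
    lintegral_pi_eq_lintegral_update ν i (f := fun x => ‖G x‖ₑ ^ r) (by fun_prop),
    ← lintegral_const_mul' _ _ (by simp), ← lintegral_add_left (by fun_prop)]
  refine lintegral_mono_ae ?_
  filter_upwards [hGi] with x hx
  simp only [hFi]
  exact lintegral_enorm_add_rpow_le (ν i) hr1 hr2 (F x)
    (hG.comp (measurable_update x)).aestronglyMeasurable hx

/-! ### Bivariate sums of independent blocks -/

/-- The bivariate sum `∑_{k < l < b} h(x_k(s), x_l(s'))` built from the coordinates `s` and `s'` of
the first `b` of the blocks `x_0, …, x_{m-1}`. -/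
noncomputable def blockSum {κ S H : Type*} [AddCommMonoid H] {m : ℕ} (h : S × S → H) (s s' : κ)
    (b : ℕ) (x : Fin m → κ → S) : H :=
  ∑ l : Fin m with l.1 < b, ∑ k : Fin m with k < l, h (x k s, x l s')

theorem measurable_blockTerm {κ S H : Type*} [MeasurableSpace S] [MeasurableSpace H] {m : ℕ}
    {h : S × S → H} (hh : Measurable h) (s s' : κ) (k l : Fin m) :
    Measurable fun x : Fin m → κ → S => h (x k s, x l s') := by
  fun_prop

section

variable {κ S H : Type*} [MeasurableSpace S] [NormedAddCommGroup H]
  [InnerProductSpace ℝ H] [CompleteSpace H] [MeasurableSpace H] [BorelSpace H]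
  [SecondCountableTopology H] {m : ℕ}

omit [InnerProductSpace ℝ H] [CompleteSpace H] in
theorem measurable_blockSum {h : S × S → H} (hh : Measurable h) (s s' : κ) (b : ℕ) :
    Measurable (blockSum (m := m) h s s' b) := by
  unfold blockSum
  exact Finset.measurable_sum _ fun l _ => Finset.measurable_sum _ fun k _ =>
    measurable_blockTerm hh s s' k l

variable (ν : Fin m → Measure (κ → S)) [∀ k, IsProbabilityMeasure (ν k)] (μ : Measure S)
  [IsProbabilityMeasure μ] (hν : ∀ k s, (ν k).map (fun y => y s) = μ)
include hν

theorem lintegral_pi_pair {k l : Fin m} (hkl : k ≠ l) (s s' : κ) {f : S × S → ℝ≥0∞}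
    (hf : Measurable f) :
    ∫⁻ x, f (x k s, x l s') ∂Measure.pi ν = ∫⁻ z, f z ∂μ.prod μ := by
  have h1 : ∀ (k : Fin m) (s : κ) (g : S → ℝ≥0∞), Measurable g →
      ∫⁻ x, g (x k s) ∂Measure.pi ν = ∫⁻ u, g u ∂μ := by
    intro k s g hg
    rw [← hν k s, lintegral_map hg (by fun_prop),
      ← (measurePreserving_eval ν k).lintegral_comp (f := fun y => g (y s)) (by fun_prop)]
  rw [lintegral_pi_eq_lintegral_update ν l (by fun_prop), lintegral_prod _ hf.aemeasurable,
    ← h1 k s _ (by fun_prop)]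
  refine lintegral_congr fun x => ?_
  simp only [Function.update_self, Function.update_of_ne hkl]
  rw [← hν l s', lintegral_map (by fun_prop) (by fun_prop)]

omit [IsProbabilityMeasure μ] in
theorem ae_pi_coord {p : S → Prop} (hp : ∀ᵐ u ∂μ, p u) (k : Fin m) (s : κ) :
    ∀ᵐ x ∂Measure.pi ν, p (x k s) := by
  rw [← hν k s] at hp
  have h1 : ∀ᵐ y ∂ν k, p (y s) := ae_of_ae_map (measurable_pi_apply s).aemeasurable hp
  exact (measurePreserving_eval ν k).quasiMeasurePreserving.ae h1

variable {h : S × S → H} (hh : Measurable h) {r : ℝ} (hr1 : 1 ≤ r) (hr2 : r ≤ 2)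
  (hleft : ∀ᵐ v ∂μ, ∫ u, h (u, v) ∂μ = 0) (hright : ∀ᵐ u ∂μ, ∫ v, h (u, v) ∂μ = 0)
include hh hr1 hr2 hleft

/-- Moments of `∑_{k < l} h(x_k(s), x_l(s'))` for a fixed `l`, adding the coordinates `x_k` one by
one. Only degeneracy in the first variable is used. -/
theorem lintegral_pi_innerSum_le (s s' : κ) (l : Fin m) :
    ∫⁻ x, ‖∑ k : Fin m with k < l, h (x k s, x l s')‖ₑ ^ r ∂Measure.pi ν
      ≤ 2 * m * ∫⁻ z, ‖h z‖ₑ ^ r ∂μ.prod μ := by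
  have key : ∀ t : Finset (Fin m), l ∉ t →
      ∫⁻ x, ‖∑ k ∈ t, h (x k s, x l s')‖ₑ ^ r ∂Measure.pi ν
        ≤ 2 * t.card * ∫⁻ z, ‖h z‖ₑ ^ r ∂μ.prod μ := by
    intro t
    induction t using Finset.induction_on with
    | empty => simp [show 0 < r by linarith]
    | insert k t hk ih =>
      intro hl
      rw [Finset.mem_insert, not_or] at hl
      have hkl : k ≠ l := Ne.symm hl.1
      simp only [Finset.sum_insert hk, add_comm (h _)]
      refine (lintegral_pi_enorm_add_rpow_le ν hr1 hr2 k
        (Finset.measurable_sum _ fun k _ => measurable_blockTerm hh s s' k l)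
        (measurable_blockTerm hh s s' k l) ?_ ?_).trans ?_
      · intro x y
        refine Finset.sum_congr rfl fun j hj => ?_
        rw [Function.update_of_ne hkl.symm, Function.update_of_ne]
        rintro rfl; exact hk hj
      · filter_upwards [ae_pi_coord ν μ hν hleft l s'] with x hx
        simp only [Function.update_self, Function.update_of_ne hkl.symm]
        rw [← hν k s, integral_map (measurable_pi_apply s).aemeasurable] at hx
        · exact hx
        · exact (by fun_prop : Measurable fun u => h (u, x l s')).aestronglyMeasurable
      · rw [lintegral_pi_pair ν μ hν hkl s s' (f := fun z => ‖h z‖ₑ ^ r) (by fun_prop),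
          Finset.card_insert_of_notMem hk]
        refine (add_le_add_left (ih hl.2) _).trans_eq ?_
        push_cast; ring
  refine (key _ (by simp)).trans ?_
  gcongr
  exact (Finset.card_le_univ _).trans_eq (Fintype.card_fin m)

variable (hint : Integrable h (μ.prod μ))
include hright hint

/-- Moment bound for the increments of `blockSum` under a product law: given the earlier blocks, the
term of index `l` is centred in the block `x_l`, by degeneracy in the second variable. -/
theorem lintegral_pi_blockSum_sub_le (s s' : κ) {a b : ℕ} (hab : a ≤ b) :
    ∫⁻ x, ‖blockSum h s s' b x - blockSum h s s' a x‖ₑ ^ r ∂Measure.pi ν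
      ≤ (4 * m * ∫⁻ z, ‖h z‖ₑ ^ r ∂μ.prod μ) * ((b - a : ℕ) : ℝ≥0∞) := by
  induction b, hab using Nat.le_induction with
  | base => simp [show 0 < r by linarith]
  | succ b hab ih =>
    by_cases hb : b < m
    · have hsucc : ∀ x : Fin m → κ → S, blockSum h s s' (b + 1) x
          = blockSum h s s' b x + ∑ k : Fin m with k < ⟨b, hb⟩, h (x k s, x ⟨b, hb⟩ s') := by
        intro x
        unfold blockSum
        have : (Finset.univ.filter fun l : Fin m => l.1 < b + 1)
            = insert ⟨b, hb⟩ (Finset.univ.filter fun l : Fin m => l.1 < b) := by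
          ext l; simp [Fin.ext_iff]; omega
        rw [this, Finset.sum_insert (by simp), add_comm]
      simp only [hsucc, add_sub_right_comm]
      have hlt : ∀ (a : ℕ), a ≤ b → ∀ (x : Fin m → κ → S) y,
          blockSum h s s' a (Function.update x ⟨b, hb⟩ y) = blockSum h s s' a x := by
        intro a ha x y
        unfold blockSum
        refine Finset.sum_congr rfl fun l hl => Finset.sum_congr rfl fun k hk => ?_
        simp only [Finset.mem_filter, Finset.mem_univ, true_and, Fin.lt_def] at hl hk
        rw [Function.update_of_ne, Function.update_of_ne]
        · simp only [ne_eq, Fin.ext_iff]; omega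
        · simp only [ne_eq, Fin.ext_iff]; omega
      refine (lintegral_pi_enorm_add_rpow_le ν hr1 hr2 ⟨b, hb⟩
        ((measurable_blockSum hh s s' b).sub (measurable_blockSum hh s s' a))
        (Finset.measurable_sum _ fun k _ => measurable_blockTerm hh s s' k _) ?_ ?_).trans ?_
      · intro x y
        simp only [Pi.sub_apply, hlt b le_rfl, hlt a hab]
      · have hall : ∀ᵐ x ∂Measure.pi ν, ∀ k : Fin m, ∫ v, h (x k s, v) ∂μ = 0 :=
          ae_all_iff.2 fun k => ae_pi_coord ν μ hν hright k s
        have hall' : ∀ᵐ x ∂Measure.pi ν, ∀ k : Fin m, Integrable (fun v => h (x k s, v)) μ :=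
          ae_all_iff.2 fun k => ae_pi_coord ν μ hν hint.prod_right_ae k s
        filter_upwards [hall, hall'] with x hx hx'
        have hupd : ∀ y, ∑ k : Fin m with k < ⟨b, hb⟩, h (Function.update x ⟨b, hb⟩ y k s,
            Function.update x ⟨b, hb⟩ y ⟨b, hb⟩ s')
              = (fun v => ∑ k : Fin m with k < ⟨b, hb⟩, h (x k s, v)) (y s') := fun y => by
          refine Finset.sum_congr rfl fun k hk => ?_
          rw [Function.update_self, Function.update_of_ne]
          exact (Finset.mem_filter.1 hk).2.ne
        simp only [hupd]
        have hmeas : Measurable fun v => ∑ k : Fin m with k < ⟨b, hb⟩, h (x k s, v) :=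
          Finset.measurable_sum _ fun k _ => by fun_prop
        have e := integral_map (μ := ν ⟨b, hb⟩) (φ := fun y : κ → S => y s')
          (measurable_pi_apply s').aemeasurable hmeas.aestronglyMeasurable
        rw [hν, integral_finsetSum _ fun k _ => hx' k, Finset.sum_eq_zero fun k _ => hx k] at e
        exact e.symm
      · refine (add_le_add ih (mul_le_mul_right (lintegral_pi_innerSum_le ν μ hν hh hr1 hr2 hleft
          s s' ⟨b, hb⟩) 2)).trans_eq ?_
        rw [Nat.succ_sub hab]; push_cast; ring
    · have hsucc : ∀ x : Fin m → κ → S, blockSum h s s' (b + 1) x = blockSum h s s' b x := by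
        intro x
        unfold blockSum
        congr 1
        ext l; simp; omega
      simp only [hsucc]
      refine ih.trans ?_
      gcongr
      omega

end

/-! ### A maximal inequality -/

/-- Dyadic chaining: linear bounds on the `r`-th moments of the increments control the maximum over
`2 ^ d` steps, at the price of a factor `(d + 1) ^ r`. The maximum over `2 ^ (d + 1)` steps is at
most the increment to the midpoint plus the larger of the two maxima over the halves. -/
theorem lintegral_iSup_rpow_le_of_increments {α H : Type*} [MeasurableSpace α] {Q : Measure α}
    [NormedAddCommGroup H] [MeasurableSpace H] [BorelSpace H] [SecondCountableTopology H]
    {r : ℝ} (hr1 : 1 ≤ r) {T : ℕ → α → H} (hT : ∀ b, Measurable (T b)) {K : ℝ≥0∞}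
    (hK : ∀ a b, a ≤ b → ∫⁻ x, ‖T b x - T a x‖ₑ ^ r ∂Q ≤ K * ((b - a : ℕ) : ℝ≥0∞)) (d a : ℕ) :
    ∫⁻ x, (⨆ j ∈ Finset.range (2 ^ d + 1), ‖T (a + j) x - T a x‖ₑ) ^ r ∂Q
      ≤ K * 2 ^ d * ((d + 1 : ℕ) : ℝ≥0∞) ^ r := by
  have hr0 : 0 < r := by linarith
  set M : ℕ → ℕ → α → ℝ≥0∞ := fun d a x =>
    ⨆ j ∈ Finset.range (2 ^ d + 1), ‖T (a + j) x - T a x‖ₑ with hM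
  have hMm : ∀ d a, Measurable (M d a) := fun d a =>
    Measurable.iSup fun j => Measurable.iSup fun _ => ((hT _).sub (hT _)).enorm
  -- In terms of `L ^ r` norms the induction step adds exactly `(K * 2 ^ d) ^ (1 / r)`.
  suffices hs : ∀ d a, (∫⁻ x, M d a x ^ r ∂Q) ^ (1 / r)
      ≤ (K * 2 ^ d) ^ (1 / r) * ((d + 1 : ℕ) : ℝ≥0∞) by
    have := ENNReal.rpow_le_rpow (hs d a) hr0.le
    rwa [ENNReal.mul_rpow_of_nonneg _ _ hr0.le, ← ENNReal.rpow_mul, ← ENNReal.rpow_mul,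
      one_div_mul_cancel hr0.ne', ENNReal.rpow_one, ENNReal.rpow_one] at this
  intro d
  induction d with
  | zero =>
    intro a
    have : ∀ x, M 0 a x = ‖T (a + 1) x - T a x‖ₑ := by
      intro x
      apply le_antisymm
      · refine iSup₂_le fun j hj => ?_
        have : j = 0 ∨ j = 1 := by
          simp at hj; omega
        rcases this with rfl | rfl <;> simp
      · exact le_iSup₂_of_le 1 (by simp) le_rfl
    simp only [this]
    have := hK a (a + 1) (by omega)
    simp only [Nat.add_sub_cancel_left, Nat.cast_one, mul_one] at this
    simpa using ENNReal.rpow_le_rpow this (by positivity)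
  | succ d ih =>
    intro a
    set F : α → ℝ≥0∞ := fun x => ‖T (a + 2 ^ d) x - T a x‖ₑ with hF
    set G : α → ℝ≥0∞ := fun x => max (M d a x) (M d (a + 2 ^ d) x) with hG
    have hFm : Measurable F := ((hT _).sub (hT _)).enorm
    have hGm : Measurable G := (hMm _ _).max (hMm _ _)
    have hle : ∀ x, M (d + 1) a x ≤ (F + G) x := by
      intro x
      refine iSup₂_le fun j hj => ?_
      simp only [Finset.mem_range, pow_succ] at hj
      by_cases hjd : j < 2 ^ d + 1
      · calc _ ≤ M d a x :=
              le_iSup₂_of_le (f := fun j _ => ‖T (a + j) x - T a x‖ₑ) j (by simpa using hjd) le_rfl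
          _ ≤ G x := le_max_left _ _
          _ ≤ _ := le_add_self
      · obtain ⟨i, rfl⟩ : ∃ i, j = 2 ^ d + i := ⟨j - 2 ^ d, by omega⟩
        calc ‖T (a + (2 ^ d + i)) x - T a x‖ₑ
            = ‖(T (a + 2 ^ d) x - T a x) + (T (a + 2 ^ d + i) x - T (a + 2 ^ d) x)‖ₑ := by
              rw [add_assoc]; congr 1; abel
          _ ≤ F x + ‖T (a + 2 ^ d + i) x - T (a + 2 ^ d) x‖ₑ := enorm_add_le _ _
          _ ≤ F x + M d (a + 2 ^ d) x := by
              gcongr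
              exact le_iSup₂_of_le
                (f := fun i _ => ‖T (a + 2 ^ d + i) x - T (a + 2 ^ d) x‖ₑ) i
                (by simp; omega) le_rfl
          _ ≤ F x + G x := by gcongr; exact le_max_right _ _
    have hFb : (∫⁻ x, F x ^ r ∂Q) ^ (1 / r) ≤ (K * 2 ^ (d + 1)) ^ (1 / r) := by
      refine ENNReal.rpow_le_rpow ((hK a (a + 2 ^ d) (Nat.le_add_right _ _)).trans ?_)
        (by positivity)
      rw [Nat.add_sub_cancel_left]; push_cast
      gcongr <;> simp
    have hIH : ∀ a, ∫⁻ x, M d a x ^ r ∂Q ≤ K * 2 ^ d * ((d + 1 : ℕ) : ℝ≥0∞) ^ r := by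
      intro a
      have := ENNReal.rpow_le_rpow (ih a) hr0.le
      rwa [ENNReal.mul_rpow_of_nonneg _ _ hr0.le, ← ENNReal.rpow_mul, ← ENNReal.rpow_mul,
        one_div_mul_cancel hr0.ne', ENNReal.rpow_one, ENNReal.rpow_one] at this
    have hGb : (∫⁻ x, G x ^ r ∂Q) ^ (1 / r)
        ≤ (K * 2 ^ (d + 1)) ^ (1 / r) * ((d + 1 : ℕ) : ℝ≥0∞) := by
      have h1 : ∫⁻ x, G x ^ r ∂Q ≤ K * 2 ^ (d + 1) * ((d + 1 : ℕ) : ℝ≥0∞) ^ r := by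
        calc ∫⁻ x, G x ^ r ∂Q ≤ ∫⁻ x, (M d a x ^ r + M d (a + 2 ^ d) x ^ r) ∂Q := by
              refine lintegral_mono fun x => ?_
              rcases le_total (M d a x) (M d (a + 2 ^ d) x) with h | h
              · simp only [hG, max_eq_right h]; exact le_add_self
              · simp only [hG, max_eq_left h]; exact le_self_add
          _ = ∫⁻ x, M d a x ^ r ∂Q + ∫⁻ x, M d (a + 2 ^ d) x ^ r ∂Q :=
              lintegral_add_left ((hMm _ _).pow_const r) _
          _ ≤ _ := add_le_add (hIH a) (hIH _)
          _ = _ := by rw [pow_succ]; ring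
      refine (ENNReal.rpow_le_rpow h1 (by positivity)).trans_eq ?_
      rw [ENNReal.mul_rpow_of_nonneg _ _ (by positivity), ← ENNReal.rpow_mul,
        mul_one_div_cancel hr0.ne', ENNReal.rpow_one]
    calc (∫⁻ x, M (d + 1) a x ^ r ∂Q) ^ (1 / r) ≤ (∫⁻ x, (F + G) x ^ r ∂Q) ^ (1 / r) := by
          gcongr with x; exact hle x
      _ ≤ _ := ENNReal.lintegral_Lp_add_le hFm.aemeasurable hGm.aemeasurable hr1
      _ ≤ _ := add_le_add hFb hGb
      _ = _ := by push_cast; ring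

/-! ### The coefficient `β` and total variation -/

theorem betaCoeff_mono {Ω : Type*} {m₀ : MeasurableSpace Ω} (P : Measure Ω)
    {m₁ m₁' m₂ m₂' : MeasurableSpace Ω} (h₁ : m₁ ≤ m₁') (h₂ : m₂ ≤ m₂') :
    betaCoeff P m₁ m₂ ≤ betaCoeff P m₁' m₂' := by
  unfold betaCoeff
  gcongr 1 / 2 * ?_
  refine iSup₂_le fun I J => iSup₂_le fun A B => iSup₂_le fun hA hB => ?_
  refine le_iSup₂_of_le I J (le_iSup₂_of_le A B (le_iSup₂_of_le ?_ ?_ le_rfl))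
  · exact ⟨fun i => h₁ _ (hA.1 i), hA.2, hA.3⟩
  · exact ⟨fun i => h₂ _ (hB.1 i), hB.2, hB.3⟩

/-- Finite unions of measurable rectangles, in the form: preimages of arbitrary sets under a
product of two measurable maps with finitely many values. -/
def finiteRectangles (α β : Type*) [MeasurableSpace α] [MeasurableSpace β] : Set (Set (α × β)) :=
  {E | ∃ (I J : ℕ) (f : α → Fin I) (g : β → Fin J) (R : Set (Fin I × Fin J)),
    Measurable f ∧ Measurable g ∧ E = {z | (f z.1, g z.2) ∈ R}}

section

variable {α β : Type*} [MeasurableSpace α] [MeasurableSpace β]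

/-- Stability under Boolean operations, by taking a common refinement of the two pairs of finite
partitions. -/
theorem finiteRectangles_combine (p : Prop → Prop → Prop) {E F : Set (α × β)}
    (hE : E ∈ finiteRectangles α β) (hF : F ∈ finiteRectangles α β) :
    {z | p (z ∈ E) (z ∈ F)} ∈ finiteRectangles α β := by
  obtain ⟨I, J, f, g, R, hf, hg, rfl⟩ := hE
  obtain ⟨I', J', f', g', R', hf', hg', rfl⟩ := hF
  refine ⟨I * I', J * J', fun x => finProdFinEquiv (f x, f' x),
    fun y => finProdFinEquiv (g y, g' y),
    {z | p (((finProdFinEquiv.symm z.1).1, (finProdFinEquiv.symm z.2).1) ∈ R)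
      (((finProdFinEquiv.symm z.1).2, (finProdFinEquiv.symm z.2).2) ∈ R')}, ?_, ?_, ?_⟩
  · exact (Measurable.of_discrete (f := finProdFinEquiv)).comp (hf.prodMk hf')
  · exact (Measurable.of_discrete (f := finProdFinEquiv)).comp (hg.prodMk hg')
  · ext z
    simp only [Set.mem_ofPred_eq, Equiv.symm_apply_apply]

theorem measurableSet_of_mem_finiteRectangles {E : Set (α × β)}
    (hE : E ∈ finiteRectangles α β) : MeasurableSet E := by
  obtain ⟨I, J, f, g, R, hf, hg, rfl⟩ := hE
  exact ((hf.comp measurable_fst).prodMk (hg.comp measurable_snd))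
    (MeasurableSet.of_discrete (s := R))

theorem prod_mem_finiteRectangles {s : Set α} {t : Set β} (hs : MeasurableSet s)
    (ht : MeasurableSet t) : s ×ˢ t ∈ finiteRectangles α β := by
  classical
  refine ⟨2, 2, fun x => if x ∈ s then 1 else 0, fun y => if y ∈ t then 1 else 0, {(1, 1)},
    Measurable.ite hs measurable_const measurable_const,
    Measurable.ite ht measurable_const measurable_const, ?_⟩
  ext z
  simp only [Set.mem_prod, Set.mem_singleton_iff, Set.mem_ofPred_eq, Prod.mk.injEq]
  split_ifs <;> simp_all

theorem isSetRing_finiteRectangles : IsSetRing (finiteRectangles α β) where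
  empty_mem := by simpa using prod_mem_finiteRectangles (α := α) (β := β) .empty .empty
  union_mem _ _ hE hF := finiteRectangles_combine (fun a b => a ∨ b) hE hF
  sdiff_mem _ _ hE hF := finiteRectangles_combine (fun a b => a ∧ ¬ b) hE hF

theorem generateFrom_finiteRectangles :
    (Prod.instMeasurableSpace : MeasurableSpace (α × β))
      = MeasurableSpace.generateFrom (finiteRectangles α β) := by
  apply le_antisymm
  · rw [← generateFrom_prod]
    refine MeasurableSpace.generateFrom_mono ?_
    rintro _ ⟨s, hs, t, ht, rfl⟩
    exact prod_mem_finiteRectangles hs ht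
  · exact MeasurableSpace.generateFrom_le fun E hE => measurableSet_of_mem_finiteRectangles hE

variable {Ω : Type*} [MeasurableSpace Ω] (P : Measure Ω) [IsProbabilityMeasure P]
  {ξ : Ω → α} {η : Ω → β} (hξ : Measurable ξ) (hη : Measurable η)
include hξ hη

/-- `map_prodMk_apply_le` for finite unions of rectangles, where it is read off the definition. -/
theorem measure_finiteRectangles_le {E : Set (α × β)} (hE : E ∈ finiteRectangles α β) :
    P.map (fun ω => (ξ ω, η ω)) E ≤ (P.map ξ).prod (P.map η) E
      + 2 * betaCoeff P (MeasurableSpace.comap ξ inferInstance)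
          (MeasurableSpace.comap η inferInstance) := by
  classical
  have hEm := measurableSet_of_mem_finiteRectangles hE
  have : IsProbabilityMeasure (P.map ξ) := Measure.isProbabilityMeasure_map hξ.aemeasurable
  have : IsProbabilityMeasure (P.map η) := Measure.isProbabilityMeasure_map hη.aemeasurable
  obtain ⟨I, J, f, g, R, hf, hg, rfl⟩ := hE
  rw [Measure.map_apply (hξ.prodMk hη) hEm]
  set A : Fin I → Set Ω := fun i => ξ ⁻¹' (f ⁻¹' {i}) with hA
  set B : Fin J → Set Ω := fun j => η ⁻¹' (g ⁻¹' {j}) with hB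
  have hfi : ∀ i, MeasurableSet (f ⁻¹' {i}) := fun i => hf (MeasurableSet.singleton i)
  have hgj : ∀ j, MeasurableSet (g ⁻¹' {j}) := fun j => hg (MeasurableSet.singleton j)
  have hpA : IsPartition (MeasurableSpace.comap ξ inferInstance) A := by
    refine ⟨fun i => ⟨_, hfi i, rfl⟩, fun i j hij => ?_, ?_⟩
    · refine Set.disjoint_left.2 fun ω h1 h2 => hij ?_
      simp only [hA, Set.mem_preimage, Set.mem_singleton_iff] at h1 h2
      exact h1.symm.trans h2
    · ext ω; simp [hA]
  have hpB : IsPartition (MeasurableSpace.comap η inferInstance) B := by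
    refine ⟨fun i => ⟨_, hgj i, rfl⟩, fun i j hij => ?_, ?_⟩
    · refine Set.disjoint_left.2 fun ω h1 h2 => hij ?_
      simp only [hB, Set.mem_preimage, Set.mem_singleton_iff] at h1 h2
      exact h1.symm.trans h2
    · ext ω; simp [hB]
  set D : Fin I → Fin J → ℝ≥0∞ := fun i j =>
    ENNReal.ofReal |P.real (A i ∩ B j) - P.real (A i) * P.real (B j)| with hD
  have hpair : ∀ i j, P (A i ∩ B j) ≤ P (A i) * P (B j) + D i j := by
    intro i j
    rw [← ofReal_measureReal (s := A i ∩ B j), ← ofReal_measureReal (s := A i),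
      ← ofReal_measureReal (s := B j), ← ENNReal.ofReal_mul measureReal_nonneg,
      ← ENNReal.ofReal_add (by positivity) (abs_nonneg _)]
    refine ENNReal.ofReal_le_ofReal ?_
    linarith [le_abs_self (P.real (A i ∩ B j) - P.real (A i) * P.real (B j))]
  have hprod : (P.map ξ).prod (P.map η) {z | (f z.1, g z.2) ∈ R}
      = ∑ u ∈ Finset.univ.filter (· ∈ R), P (A u.1) * P (B u.2) := by
    have : {z : α × β | (f z.1, g z.2) ∈ R}
        = ⋃ u ∈ Finset.univ.filter (· ∈ R), (f ⁻¹' {u.1}) ×ˢ (g ⁻¹' {u.2}) := by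
      ext z; simp
    rw [this, measure_biUnion_finset]
    · refine Finset.sum_congr rfl fun u _ => ?_
      rw [Measure.prod_prod, Measure.map_apply hξ (hfi _), Measure.map_apply hη (hgj _)]
    · intro u _ v _ huv
      refine Set.disjoint_left.2 fun z h1 h2 => huv ?_
      simp only [Set.mem_prod, Set.mem_preimage, Set.mem_singleton_iff] at h1 h2
      exact Prod.ext (h1.1.symm.trans h2.1) (h1.2.symm.trans h2.2)
    · exact fun u _ => (hfi _).prod (hgj _)
  have hsup : ∑ i, ∑ j, D i j ≤ 2 * betaCoeff P (MeasurableSpace.comap ξ inferInstance)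
          (MeasurableSpace.comap η inferInstance) := by
    unfold betaCoeff
    rw [← mul_assoc, one_div, ENNReal.mul_inv_cancel two_ne_zero (by simp), one_mul]
    exact le_iSup₂_of_le I J (le_iSup₂_of_le A B (le_iSup₂_of_le hpA hpB le_rfl))
  calc P ((fun ω => (ξ ω, η ω)) ⁻¹' {z | (f z.1, g z.2) ∈ R})
      ≤ P (⋃ u ∈ Finset.univ.filter (· ∈ R), A u.1 ∩ B u.2) := by
        refine measure_mono fun ω hω => ?_
        simp only [Set.mem_iUnion]
        exact ⟨(f (ξ ω), g (η ω)), by simpa using hω, rfl, rfl⟩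
    _ ≤ ∑ u ∈ Finset.univ.filter (· ∈ R), P (A u.1 ∩ B u.2) := measure_biUnion_finset_le _ _
    _ ≤ ∑ u ∈ Finset.univ.filter (· ∈ R), (P (A u.1) * P (B u.2) + D u.1 u.2) :=
        Finset.sum_le_sum fun u _ => hpair _ _
    _ = (P.map ξ).prod (P.map η) {z | (f z.1, g z.2) ∈ R}
        + ∑ u ∈ Finset.univ.filter (· ∈ R), D u.1 u.2 := by
        rw [Finset.sum_add_distrib, hprod]
    _ ≤ _ := by
        gcongr
        refine le_trans ?_ hsup
        rw [← Fintype.sum_prod_type']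
        exact Finset.sum_le_sum_of_subset (Finset.filter_subset _ _)

/-- Twice the coefficient `β` bounds the distance in total variation between the law of a pair and
the product of the marginal laws: finite unions of rectangles approximate every measurable set,
with respect to the sum of the two laws. -/
theorem map_prodMk_apply_le {E : Set (α × β)} (hE : MeasurableSet E) :
    P.map (fun ω => (ξ ω, η ω)) E ≤ (P.map ξ).prod (P.map η) E
      + 2 * betaCoeff P (MeasurableSpace.comap ξ inferInstance)
          (MeasurableSpace.comap η inferInstance) := by
  have : IsProbabilityMeasure (P.map ξ) := Measure.isProbabilityMeasure_map hξ.aemeasurable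
  have : IsProbabilityMeasure (P.map η) := Measure.isProbabilityMeasure_map hη.aemeasurable
  have : IsProbabilityMeasure (P.map fun ω => (ξ ω, η ω)) :=
    Measure.isProbabilityMeasure_map (hξ.prodMk hη).aemeasurable
  set b := 2 * betaCoeff P (MeasurableSpace.comap ξ inferInstance)
          (MeasurableSpace.comap η inferInstance) with hb
  set μ₁ := P.map (fun ω => (ξ ω, η ω))
  set μ₂ := (P.map ξ).prod (P.map η)
  refine ENNReal.le_of_forall_pos_le_add fun ε hε _ => ?_
  obtain ⟨t, ht, hlt⟩ := exists_measure_symmDiff_lt_of_generateFrom_isSetRing (μ := μ₁ + μ₂)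
    isSetRing_finiteRectangles ⟨{Set.univ}, by simp, by
      simpa using prod_mem_finiteRectangles (α := α) (β := β) .univ .univ, by simp⟩
    generateFrom_finiteRectangles hE (ε := ε) (by exact_mod_cast hε)
  rw [Measure.add_apply] at hlt
  have h1 : μ₁ E ≤ μ₁ t + μ₁ (symmDiff t E) :=
    (measure_mono fun z hz => by by_cases h : z ∈ t <;> simp [h, hz, Set.mem_symmDiff]).trans
      (measure_union_le _ _)
  have h2 : μ₂ t ≤ μ₂ E + μ₂ (symmDiff t E) :=
    (measure_mono fun z hz => by by_cases h : z ∈ E <;> simp [h, hz, Set.mem_symmDiff]).trans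
      (measure_union_le _ _)
  calc μ₁ E ≤ μ₁ t + μ₁ (symmDiff t E) := h1
    _ ≤ (μ₂ t + b) + μ₁ (symmDiff t E) := by
        gcongr; exact measure_finiteRectangles_le P hξ hη ht
    _ ≤ (μ₂ E + μ₂ (symmDiff t E) + b) + μ₁ (symmDiff t E) := by gcongr
    _ = μ₂ E + b + (μ₁ (symmDiff t E) + μ₂ (symmDiff t E)) := by ring
    _ ≤ μ₂ E + b + ε := by gcongr

end

/-- Replacing a finite sequence of random variables by independent ones with the same marginals
costs `2 b` per variable. -/
theorem map_pi_apply_le {Ω α : Type*} [MeasurableSpace Ω] [MeasurableSpace α] (P : Measure Ω)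
    [IsProbabilityMeasure P] {B : ℕ → Ω → α} (hB : ∀ k, Measurable (B k)) {b : ℝ≥0∞}
    (hb : ∀ m, betaCoeff P (MeasurableSpace.comap (fun ω (k : Fin m) => B k ω) inferInstance)
      (MeasurableSpace.comap (B m) inferInstance) ≤ b) (m : ℕ) {E : Set (Fin m → α)}
    (hE : MeasurableSet E) :
    P.map (fun ω (k : Fin m) => B k ω) E
      ≤ Measure.pi (fun k : Fin m => P.map (B k)) E + 2 * m * b := by
  have hpr : ∀ k, IsProbabilityMeasure (P.map (B k)) := fun k =>
    Measure.isProbabilityMeasure_map (hB k).aemeasurable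
  have hpast : ∀ m, Measurable fun ω (k : Fin m) => B k ω := fun m =>
    measurable_pi_lambda _ fun k => hB k
  induction m with
  | zero =>
    rcases E.eq_empty_or_nonempty with rfl | hne
    · simp
    · have := Measure.isProbabilityMeasure_map (μ := P) (hpast 0).aemeasurable
      rw [Subsingleton.eq_univ_of_nonempty hne, measure_univ, measure_univ]
      exact le_self_add
  | succ m ih =>
    set e := MeasurableEquiv.piFinSuccAbove (fun _ : Fin (m + 1) => α) (Fin.last m) with he
    set F : Set ((Fin m → α) × α) := {z | e.symm (z.2, z.1) ∈ E} with hF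
    have hFm : MeasurableSet F :=
      (e.symm.measurable.comp (measurable_snd.prodMk measurable_fst)) hE
    have h1 : P.map (fun ω (k : Fin (m + 1)) => B k ω) E
        = P.map (fun ω => ((fun k : Fin m => B k ω), B m ω)) F := by
      rw [Measure.map_apply (hpast _) hE, Measure.map_apply ((hpast m).prodMk (hB m)) hFm]
      congr 1
      ext ω
      simp only [Set.mem_preimage, hF, Set.mem_ofPred_eq]
      have : e.symm (B m ω, fun k : Fin m => B k ω) = fun k : Fin (m + 1) => B k ω := by
        rw [MeasurableEquiv.symm_apply_eq]
        ext1
        · simp [he, MeasurableEquiv.piFinSuccAbove]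
        · ext1 k; simp [he, MeasurableEquiv.piFinSuccAbove, Fin.init]
      rw [this]
    have h2 : Measure.pi (fun k : Fin (m + 1) => P.map (B k)) E
        = (Measure.pi (fun k : Fin m => P.map (B k))).prod (P.map (B m)) F := by
      have hmp := measurePreserving_piFinSuccAbove (fun k : Fin (m + 1) => P.map (B k)) (Fin.last m)
      have h3 := hmp.symm.measure_preimage_equiv E
      rw [← h3]
      simp only [Fin.succAbove_last, Fin.val_last, Fin.val_castSucc]
      rw [← Measure.prod_swap, Measure.map_apply measurable_swap]
      · rfl
      · exact e.symm.measurable hE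
    rw [h1, h2]
    refine (map_prodMk_apply_le P (hpast m) (hB m) hFm).trans ?_
    rw [Measure.prod_apply_symm hFm, Measure.prod_apply_symm hFm]
    calc _ ≤ ∫⁻ y, (Measure.pi (fun k : Fin m => P.map (B k)) ((fun x => (x, y)) ⁻¹' F)
            + 2 * m * b) ∂P.map (B m) + 2 * b := by
          gcongr with y
          · exact ih (measurable_prodMk_right hFm)
          · exact hb m
      _ = _ := by
          rw [lintegral_add_right _ measurable_const, lintegral_const, measure_univ]
          push_cast; ring

/-! ### Blocks of a stationary process -/

/-- The functional `∑_{s, s'} max_{b ≤ m} ‖∑_{k < l < b} h(x_k(s), x_l(s'))‖` of `m` blocks. -/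
noncomputable def blockMax {S H : Type*} [NormedAddCommGroup H] {m n : ℕ} (h : S × S → H)
    (x : Fin m → Fin n → S) : ℝ≥0∞ :=
  ∑ u : Fin n × Fin n, ⨆ b ∈ Finset.range (m + 1), ‖blockSum h u.1 u.2 b x‖ₑ

section

variable {S H : Type*} [MeasurableSpace S] [NormedAddCommGroup H]
  [InnerProductSpace ℝ H] [CompleteSpace H] [MeasurableSpace H] [BorelSpace H]
  [SecondCountableTopology H] {m n : ℕ}

omit [InnerProductSpace ℝ H] [CompleteSpace H] in
theorem measurable_blockMax {h : S × S → H} (hh : Measurable h) :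
    Measurable (blockMax (m := m) (n := n) h) := by
  unfold blockMax
  exact Finset.measurable_sum _ fun u _ => Measurable.iSup fun b => Measurable.iSup fun _ =>
    (measurable_blockSum hh u.1 u.2 b).enorm

/-- Moment bound for `blockMax` under a product law. -/
theorem lintegral_pi_blockMax_rpow_le {d : ℕ} (hm : m = 2 ^ d)
    (ν : Fin m → Measure (Fin n → S)) [∀ k, IsProbabilityMeasure (ν k)] (μ : Measure S)
    [IsProbabilityMeasure μ] (hν : ∀ k s, (ν k).map (fun y => y s) = μ)
    {h : S × S → H} (hh : Measurable h) {r : ℝ} (hr1 : 1 ≤ r) (hr2 : r ≤ 2)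
    (hleft : ∀ᵐ v ∂μ, ∫ u, h (u, v) ∂μ = 0) (hright : ∀ᵐ u ∂μ, ∫ v, h (u, v) ∂μ = 0)
    (hint : Integrable h (μ.prod μ)) :
    ∫⁻ x, blockMax h x ^ r ∂Measure.pi ν ≤ ((n : ℝ≥0∞) ^ 2) ^ r *
      (4 * (m : ℝ≥0∞) ^ 2 * ((d + 1 : ℕ) : ℝ≥0∞) ^ r * ∫⁻ z, ‖h z‖ₑ ^ r ∂μ.prod μ) := by
  have hr0 : 0 < r := by linarith
  set K := ∫⁻ z, ‖h z‖ₑ ^ r ∂μ.prod μ with hK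
  have hone : ∀ u : Fin n × Fin n,
      ∫⁻ x, (⨆ b ∈ Finset.range (m + 1), ‖blockSum h u.1 u.2 b x‖ₑ) ^ r ∂Measure.pi ν
        ≤ 4 * (m : ℝ≥0∞) ^ 2 * ((d + 1 : ℕ) : ℝ≥0∞) ^ r * K := by
    intro u
    have := lintegral_iSup_rpow_le_of_increments (Q := Measure.pi ν) hr1
      (T := fun b => blockSum h u.1 u.2 b) (fun b => measurable_blockSum hh _ _ b)
      (fun a b hab => lintegral_pi_blockSum_sub_le ν μ hν hh hr1 hr2 hleft hright hint
        u.1 u.2 hab) d 0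
    have h0 : ∀ x : Fin m → Fin n → S, blockSum h u.1 u.2 0 x = 0 := fun x => by simp [blockSum]
    simp only [h0, sub_zero, zero_add] at this
    rw [← hm] at this
    refine this.trans_eq ?_
    have hm' : (2 : ℝ≥0∞) ^ d = m := by rw [hm]; push_cast; rfl
    rw [hm']; ring
  have hmeas : ∀ u : Fin n × Fin n, Measurable fun x : Fin m → Fin n → S =>
      (⨆ b ∈ Finset.range (m + 1), ‖blockSum h u.1 u.2 b x‖ₑ) ^ r := fun u =>
    (Measurable.iSup fun b => Measurable.iSup fun _ =>
      (measurable_blockSum hh u.1 u.2 b).enorm).pow_const r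
  have hcard : (Finset.univ : Finset (Fin n × Fin n)).card = n ^ 2 := by
    simp [sq]
  calc ∫⁻ x, blockMax h x ^ r ∂Measure.pi ν
      ≤ ∫⁻ x, ((n ^ 2 : ℕ) : ℝ≥0∞) ^ (r - 1) * ∑ u : Fin n × Fin n,
          (⨆ b ∈ Finset.range (m + 1), ‖blockSum h u.1 u.2 b x‖ₑ) ^ r ∂Measure.pi ν := by
        refine lintegral_mono fun x => ?_
        rw [← hcard]
        exact ENNReal.rpow_sum_le_const_mul_sum_rpow _ _ hr1
    _ = ((n ^ 2 : ℕ) : ℝ≥0∞) ^ (r - 1) * ∑ u : Fin n × Fin n, ∫⁻ x,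
          (⨆ b ∈ Finset.range (m + 1), ‖blockSum h u.1 u.2 b x‖ₑ) ^ r ∂Measure.pi ν := by
        rw [lintegral_const_mul _ (Finset.measurable_sum _ fun u _ => hmeas u),
          lintegral_finsetSum _ fun u _ => hmeas u]
    _ ≤ ((n ^ 2 : ℕ) : ℝ≥0∞) ^ (r - 1) * ∑ u : Fin n × Fin n,
          (4 * (m : ℝ≥0∞) ^ 2 * ((d + 1 : ℕ) : ℝ≥0∞) ^ r * K) := by
        gcongr with u; exact hone u
    _ = _ := by
        rw [Finset.sum_const, hcard, nsmul_eq_mul, ← mul_assoc]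
        congr 1
        rcases Nat.eq_zero_or_pos n with rfl | hn
        · simp [hr0]
        · rw [← Nat.cast_pow]
          have h1 : ((n ^ 2 : ℕ) : ℝ≥0∞) ≠ 0 := by positivity
          conv_lhs => rw [← ENNReal.rpow_one ((n ^ 2 : ℕ) : ℝ≥0∞), ← ENNReal.rpow_mul, one_mul]
          rw [← ENNReal.rpow_add _ _ h1 (by simp)]
          congr 1; ring

end

section

variable {Ω S : Type*} [MeasurableSpace Ω] [MeasurableSpace S] {P : Measure Ω}
  {X : ℤ → Ω → S}

theorem StrictlyStationary.map_eq (hstat : StrictlyStationary P X) (i : ℤ) :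
    P.map (X i) = P.map (X 1) := by
  have h := (hstat (i - 1)).comp (u := fun x : ℤ → S => x 1) (measurable_pi_apply 1)
  have := h.map_eq
  simpa [Function.comp_def] using this

theorem StrictlyStationary.identDistrib_pair (hstat : StrictlyStationary P X) (i j : ℤ) :
    IdentDistrib (fun ω => (X i ω, X j ω)) (fun ω => (X 1 ω, X (j - i + 1) ω)) P P := by
  have h := (hstat (i - 1)).comp (u := fun x : ℤ → S => (x 1, x (j - i + 1)))
    ((measurable_pi_apply 1).prodMk (measurable_pi_apply _))
  simpa [Function.comp_def] using h

omit [MeasurableSpace Ω] in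
theorem measurable_sigmaGen {s : Set ℤ} {i : ℤ} (hi : i ∈ s) :
    Measurable[sigmaGen X s] (X i) :=
  measurable_iff_comap_le.2 (le_iSup₂ (f := fun i (_ : i ∈ s) =>
    MeasurableSpace.comap (X i) inferInstance) i hi)

end

/-- The `k`-th block of variables, of length `3 q`, starting at the index `1 + (w + 1) q + 4 q k`.
Consecutive blocks with the same `w` are separated by a gap of length `q`; varying `w` moves the
gaps. -/
def block {Ω S : Type*} (X : ℤ → Ω → S) (q w k : ℕ) (ω : Ω) (s : Fin (3 * q)) : S :=
  X (((w + 1) * q + s + k * (4 * q) + 1 : ℕ) : ℤ) ω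

theorem measurable_block {Ω S : Type*} [MeasurableSpace Ω] [MeasurableSpace S] {X : ℤ → Ω → S}
    (hX : ∀ i, Measurable (X i)) (q w k : ℕ) : Measurable (block X q w k) :=
  measurable_pi_lambda _ fun _ => hX _

/-- The gap of length `q` before the block of index `m`. Since the first block starts after the
index `q`, the claim also holds for `m = 0`, where the past is empty. -/
theorem betaCoeff_block_le {Ω S : Type*} [MeasurableSpace Ω] [MeasurableSpace S] (P : Measure Ω)
    (X : ℤ → Ω → S) (q w m : ℕ) :
    betaCoeff P (MeasurableSpace.comap (fun ω (k : Fin m) => block X q w k ω) inferInstance)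
      (MeasurableSpace.comap (block X q w m) inferInstance) ≤ beta P X q := by
  refine le_trans (betaCoeff_mono P
    (m₁' := sigmaGen X (Set.Icc 1 ((w * q + m * (4 * q) + 1 : ℕ) : ℤ)))
    (m₂' := sigmaGen X (Set.Ici (((w * q + m * (4 * q) + 1 : ℕ) : ℤ) + (q : ℤ)))) ?_ ?_) ?_
  · refine measurable_iff_comap_le.1 ?_
    refine @measurable_pi_lambda _ _ _ (_) _ _ fun k => @measurable_pi_lambda _ _ _ (_) _ _ fun s =>
      measurable_sigmaGen ?_
    rw [Set.mem_Icc]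
    have hk : k.1 + 1 ≤ m := k.2
    have hs := s.2
    constructor
    · norm_cast; omega
    · have : (k.1 + 1) * (4 * q) ≤ m * (4 * q) := Nat.mul_le_mul_right _ hk
      norm_cast
      nlinarith
  · refine measurable_iff_comap_le.1 ?_
    refine @measurable_pi_lambda _ _ _ (_) _ _ fun s => measurable_sigmaGen ?_
    rw [Set.mem_Ici]
    norm_cast
    nlinarith [Nat.zero_le s.1]
  · exact le_iSup₂_of_le (f := fun (l : ℤ) (_ : 1 ≤ l) =>
      betaCoeff P (sigmaGen X (Set.Icc 1 l)) (sigmaGen X (Set.Ici (l + (q : ℤ))))) _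
      (by norm_cast; omega) le_rfl

/-- Deviation bound for the blocks of the process: pass to independent blocks at the cost of the
`β` term, and apply Markov's inequality there. -/
theorem measure_blockMax_gt_le {Ω S H : Type*} [MeasurableSpace Ω] [MeasurableSpace S]
    [NormedAddCommGroup H] [InnerProductSpace ℝ H] [CompleteSpace H] [MeasurableSpace H]
    [BorelSpace H] [SecondCountableTopology H] {P : Measure Ω} [IsProbabilityMeasure P]
    {X : ℤ → Ω → S} (hX : ∀ i, Measurable (X i)) (hstat : StrictlyStationary P X)
    {h : S × S → H} (hh : Measurable h) {r : ℝ} (hr1 : 1 ≤ r) (hr2 : r ≤ 2)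
    (hleft : ∀ᵐ v ∂P.map (X 1), ∫ u, h (u, v) ∂P.map (X 1) = 0)
    (hright : ∀ᵐ u ∂P.map (X 1), ∫ v, h (u, v) ∂P.map (X 1) = 0)
    (hint : Integrable h ((P.map (X 1)).prod (P.map (X 1)))) (q w d : ℕ) {t : ℝ≥0∞} (ht0 : t ≠ 0)
    (ht : t ≠ ∞) :
    P {ω | t < blockMax h fun k : Fin (2 ^ d) => block X q w k ω} ≤
      (((3 * q : ℕ) : ℝ≥0∞) ^ 2) ^ r * (4 * ((2 ^ d : ℕ) : ℝ≥0∞) ^ 2 * ((d + 1 : ℕ) : ℝ≥0∞) ^ r *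
        ∫⁻ z, ‖h z‖ₑ ^ r ∂(P.map (X 1)).prod (P.map (X 1))) / t ^ r
      + 2 * ((2 ^ d : ℕ) : ℝ≥0∞) * beta P X q := by
  have hr0 : 0 < r := by linarith
  have : IsProbabilityMeasure (P.map (X 1)) := Measure.isProbabilityMeasure_map (hX 1).aemeasurable
  have hpr : ∀ k : Fin (2 ^ d), IsProbabilityMeasure (P.map (block X q w k)) := fun k =>
    Measure.isProbabilityMeasure_map (measurable_block hX q w k).aemeasurable
  have hmeas := measurable_blockMax (m := 2 ^ d) (n := 3 * q) hh
  have hE : MeasurableSet {x : Fin (2 ^ d) → Fin (3 * q) → S | t < blockMax h x} :=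
    measurableSet_lt measurable_const hmeas
  have h1 := map_pi_apply_le P (measurable_block hX q w) (betaCoeff_block_le P X q w) (2 ^ d) hE
  rw [Measure.map_apply (measurable_pi_lambda (fun ω (k : Fin (2 ^ d)) => block X q w k ω)
    fun k => measurable_block hX q w k) hE] at h1
  refine h1.trans ?_
  gcongr
  have hν : ∀ (k : Fin (2 ^ d)) (s : Fin (3 * q)),
      (P.map (block X q w k)).map (fun y => y s) = P.map (X 1) := fun k s => by
    rw [Measure.map_map (measurable_pi_apply s) (measurable_block hX q w k)]
    exact hstat.map_eq _
  refine le_trans ?_ (ENNReal.div_le_div_right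
    (lintegral_pi_blockMax_rpow_le rfl _ _ hν hh hr1 hr2 hleft hright hint) _)
  refine le_trans (measure_mono fun x hx => ?_) (meas_ge_le_lintegral_div
    (hmeas.pow_const r).aemeasurable (by simp [ht0, ht, hr0])
    (ENNReal.rpow_ne_top_of_nonneg hr0.le ht))
  exact ENNReal.rpow_le_rpow (le_of_lt hx) hr0.le

/-! ### Degeneracy of the kernel -/

section

variable {S H : Type*} [MeasurableSpace S] [NormedAddCommGroup H] [NormedSpace ℝ H]
  [CompleteSpace H] {μ : Measure S} [IsProbabilityMeasure μ] {h : S × S → H}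

/-- The partial integral vanishes almost everywhere if its integrals over all measurable sets do. -/
theorem ae_integral_snd_eq_zero (hint : Integrable h (μ.prod μ))
    (h0 : ∀ A : Set S, MeasurableSet A → ∫ z in A ×ˢ Set.univ, h z ∂μ.prod μ = 0) :
    ∀ᵐ u ∂μ, ∫ v, h (u, v) ∂μ = 0 := by
  refine hint.integral_prod_left.ae_eq_zero_of_forall_setIntegral_eq_zero fun A hA _ => ?_
  have := setIntegral_prod h (hint.integrableOn (s := A ×ˢ Set.univ))
  rw [h0 A hA] at this
  simpa using this.symm

end

section

variable {Ω S H : Type*} [MeasurableSpace Ω] {P : Measure Ω} [IsProbabilityMeasure P]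
  [MeasurableSpace S] [NormedAddCommGroup H] [NormedSpace ℝ H] [CompleteSpace H]
  {h : S × S → H} {Y : Ω → S} (hY : Measurable Y)
include hY

theorem measurePreserving_prodMap :
    MeasurePreserving (Prod.map Y Y) (P.prod P) ((P.map Y).prod (P.map Y)) := by
  have : IsProbabilityMeasure (P.map Y) := Measure.isProbabilityMeasure_map hY.aemeasurable
  exact (hY.measurePreserving P).prod (hY.measurePreserving P)

variable (hint : Integrable h ((P.map Y).prod (P.map Y)))
include hint

theorem setIntegral_eq_zero_of_condExp {g : Ω × Ω → S} (hg : Measurable g)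
    (h0 : (P.prod P)[copyPair h Y | MeasurableSpace.comap g inferInstance] =ᵐ[P.prod P] 0)
    {A : Set S} (hA : MeasurableSet A) : ∫ w in g ⁻¹' A, copyPair h Y w ∂P.prod P = 0 := by
  have hi : Integrable (copyPair h Y) (P.prod P) :=
    (measurePreserving_prodMap hY).integrable_comp_of_integrable hint
  rw [← setIntegral_condExp hg.comap_le hi ⟨A, hA, rfl⟩,
    setIntegral_congr_ae (g := fun _ => 0) (hg hA) (h0.mono fun _ hx _ => hx)]
  simp

/-- Degeneracy, stated on the law of the variable: both partial integrals of the kernel vanish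
almost everywhere. -/
theorem IsDegenerate.ae_integral_eq_zero (hdeg : IsDegenerate P h Y) :
    (∀ᵐ v ∂P.map Y, ∫ u, h (u, v) ∂P.map Y = 0) ∧
      ∀ᵐ u ∂P.map Y, ∫ v, h (u, v) ∂P.map Y = 0 := by
  have : IsProbabilityMeasure (P.map Y) := Measure.isProbabilityMeasure_map hY.aemeasurable
  have hmp := measurePreserving_prodMap (P := P) hY
  have hset : ∀ B : Set (S × S), MeasurableSet B →
      ∫ z in B, h z ∂(P.map Y).prod (P.map Y)
        = ∫ w in Prod.map Y Y ⁻¹' B, copyPair h Y w ∂P.prod P := by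
    intro B hB
    rw [← hmp.map_eq, setIntegral_map hB (hmp.map_eq ▸ hint.aestronglyMeasurable)
      hmp.measurable.aemeasurable]
    rfl
  constructor
  · refine ae_integral_snd_eq_zero (h := h ∘ Prod.swap) hint.swap fun A hA => ?_
    have hsw : MeasurePreserving Prod.swap ((P.map Y).prod (P.map Y))
      ((P.map Y).prod (P.map Y)) := Measure.measurePreserving_swap
    have e := hsw.setIntegral_preimage_emb MeasurableEquiv.prodComm.measurableEmbedding h
      (Set.univ ×ˢ A)
    rw [Set.preimage_swap_prod] at e
    refine e.trans ((hset _ (.prod .univ hA)).trans ?_)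
    rw [← setIntegral_eq_zero_of_condExp hY hint (hY.comp measurable_snd) hdeg.2 hA]
    congr 2
    ext w; simp
  · refine ae_integral_snd_eq_zero hint fun A hA => ?_
    refine (hset _ (.prod hA .univ)).trans ?_
    rw [← setIntegral_eq_zero_of_condExp hY hint (hY.comp measurable_fst) hdeg.1 hA]
    congr 2
    ext w; simp

end

/-! ### Splitting the pairs of indices into blocks -/

/-- The pairs `i < j < n`. -/
def pairs (n : ℕ) : Finset (ℕ × ℕ) :=
  (Finset.range n ×ˢ Finset.range n).filter fun p => p.1 < p.2

theorem mem_pairs {n : ℕ} {p : ℕ × ℕ} : p ∈ pairs n ↔ p.1 < p.2 ∧ p.2 < n := by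
  simp only [pairs, Finset.mem_filter, Finset.mem_product, Finset.mem_range]; omega

/-- The pairs `i < j < n` for which `j - i < L` or `i < L`. -/
def nearPairs (L n : ℕ) : Finset (ℕ × ℕ) :=
  (pairs n).filter fun p => p.1 < L ∨ p.2 < p.1 + L

theorem card_nearPairs_le (L n : ℕ) : (nearPairs L n).card ≤ 2 * (n * L) := by
  have hsub : nearPairs L n ⊆ (Finset.range L ×ˢ Finset.range n) ∪
      (Finset.range n ×ˢ Finset.range L).image fun p => (p.1, p.1 + p.2) := by
    intro p hp
    simp only [nearPairs, Finset.mem_filter, mem_pairs] at hp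
    simp only [Finset.mem_union, Finset.mem_product, Finset.mem_range, Finset.mem_image]
    rcases hp.2 with h | h
    · left; omega
    · right; exact ⟨(p.1, p.2 - p.1), by simp only []; omega, by ext <;> simp only []; omega⟩
  calc _ ≤ _ := Finset.card_le_card hsub
    _ ≤ _ := Finset.card_union_le _ _
    _ ≤ L * n + n * L := by
        gcongr
        · simp
        · exact Finset.card_image_le.trans (by simp)
    _ = _ := by ring

/-- An element of `{0, 1, 2}` different from `u` and from `v`. -/
def avoid (u v : ℕ) : ℕ := if u ≠ 0 ∧ v ≠ 0 then 0 else if u ≠ 1 ∧ v ≠ 1 then 1 else 2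

theorem avoid_spec (u v : ℕ) : avoid u v < 3 ∧ avoid u v ≠ u ∧ avoid u v ≠ v := by
  unfold avoid; split_ifs <;> omega

/-- The residue of `i - (w + 1) q` modulo `4 q`. -/
def offset (q w i : ℕ) : ℕ := (i + (4 * q - (w + 1) * q)) % (4 * q)

/-- The index of the sub-interval of length `q` omitted for the pair `(i, j)`, together with the
offsets of `i` and `j` from the end of the omitted sub-interval. -/
def offsetClass (q : ℕ) (p : ℕ × ℕ) : ℕ × ℕ × ℕ :=
  let w := avoid (p.1 % (4 * q) / q) (p.2 % (4 * q) / q)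
  (w, offset q w p.1, offset q w p.2)

theorem offset_lt {q w i : ℕ} (hq : 0 < q) (hw : w < 3) (hi : w ≠ i % (4 * q) / q) :
    offset q w i < 3 * q := by
  unfold offset
  have ha : i % (4 * q) < 4 * q := Nat.mod_lt _ (by omega)
  rw [Nat.add_mod]
  generalize i % (4 * q) = a at *
  have hcase : a < w * q ∨ (w + 1) * q ≤ a := by
    rcases lt_or_gt_of_ne hi with h | h
    · right; exact (Nat.le_div_iff_mul_le hq).1 h
    · left; exact (Nat.div_lt_iff_lt_mul hq).1 h
  have hc : (w + 1) * q = w * q + q := by ring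
  have hc3 : w * q ≤ 2 * q := Nat.mul_le_mul_right _ (by omega)
  rw [hc] at hcase ⊢
  generalize w * q = c at *
  rw [Nat.mod_eq_of_lt (show 4 * q - (c + q) < 4 * q by omega)]
  rcases hcase with h | h
  · rw [Nat.mod_eq_of_lt (by omega)]; omega
  · have : a + (4 * q - (c + q)) = (a - (c + q)) + 4 * q := by omega
    rw [this, Nat.add_mod_right, Nat.mod_eq_of_lt (by omega)]; omega

theorem offset_injective_mod {q w i i' : ℕ} (h : offset q w i = offset q w i') :
    i % (4 * q) = i' % (4 * q) :=
  Nat.ModEq.add_right_cancel' (4 * q - (w + 1) * q) h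

theorem offset_add {q w s k : ℕ} (hw : w < 3) (hs : s < 3 * q) :
    offset q w ((w + 1) * q + s + k * (4 * q)) = s := by
  unfold offset
  have hc3 : (w + 1) * q ≤ 3 * q := Nat.mul_le_mul_right _ (by omega)
  have : (w + 1) * q + s + k * (4 * q) + (4 * q - (w + 1) * q) = s + (k + 1) * (4 * q) := by
    rw [add_mul k]; omega
  rw [this, Nat.add_mul_mod_self_right, Nat.mod_eq_of_lt (by omega)]

theorem eq_of_offset {q w i : ℕ} (hw : w < 3) (hi : (w + 1) * q ≤ i) :
    i = (w + 1) * q + offset q w i + (i - (w + 1) * q) / (4 * q) * (4 * q) := by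
  unfold offset
  have hc3 : (w + 1) * q ≤ 3 * q := Nat.mul_le_mul_right _ (by omega)
  have : i + (4 * q - (w + 1) * q) = (i - (w + 1) * q) + 4 * q := by omega
  rw [this, Nat.add_mod_right]
  have := Nat.mod_add_div' (i - (w + 1) * q) (4 * q)
  omega

theorem offsetClass_mem {q : ℕ} (hq : 0 < q) (p : ℕ × ℕ) :
    offsetClass q p ∈ Finset.range 3 ×ˢ Finset.range (3 * q) ×ˢ Finset.range (3 * q) := by
  obtain ⟨h1, h2, h3⟩ := avoid_spec (p.1 % (4 * q) / q) (p.2 % (4 * q) / q)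
  simp only [offsetClass, Finset.mem_product, Finset.mem_range]
  exact ⟨h1, offset_lt hq h1 h2, offset_lt hq h1 h3⟩

/-- For the blocks with parameter `w`, the pairs whose offsets are `s` and `s'` and which lie in
different blocks form a sum of the type of `blockSum`; all the other pairs of the class
`(w, s, s')` are near pairs. -/
theorem enorm_sum_offsetClass_le {H : Type*} [NormedAddCommGroup H] (g : ℕ × ℕ → H) {q m n : ℕ}
    (hq : 0 < q) (hn : n ≤ m * (4 * q)) {w s s' : ℕ} (hw : w < 3) (hs : s < 3 * q)
    (hs' : s' < 3 * q) :
    ‖∑ p ∈ (pairs n).filter (fun p => offsetClass q p = (w, s, s')), g p‖ₑ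
      ≤ ∑ p ∈ (nearPairs (4 * q) n).filter (fun p => offsetClass q p = (w, s, s')), ‖g p‖ₑ
        + ⨆ b ∈ Finset.range (m + 1), ‖∑ l ∈ Finset.range b, ∑ k ∈ Finset.range l,
            g ((w + 1) * q + s + k * (4 * q), (w + 1) * q + s' + l * (4 * q))‖ₑ := by
  set F := (pairs n).filter (fun p => offsetClass q p = (w, s, s')) with hF
  rcases F.eq_empty_or_nonempty with hFe | ⟨p₀, hp₀⟩
  · rw [hFe]; simp
  -- As the class is not empty, it consists of all pairs with the same residues modulo `4 q`.
  have hcls : ∀ p : ℕ × ℕ, offsetClass q p = (w, s, s') ↔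
      offset q w p.1 = s ∧ offset q w p.2 = s' := by
    have h₀ := (Finset.mem_filter.1 hp₀).2
    intro p
    constructor
    · intro hp
      simp only [offsetClass, Prod.mk.injEq] at hp
      obtain ⟨rfl, h1, h2⟩ := hp
      exact ⟨h1, h2⟩
    · rintro ⟨h1, h2⟩
      have h₀' := h₀
      simp only [offsetClass, Prod.mk.injEq] at h₀'
      obtain ⟨e0, e1, e2⟩ := h₀'
      rw [e0] at e1 e2
      have i1 := offset_injective_mod (h1.trans e1.symm)
      have i2 := offset_injective_mod (h2.trans e2.symm)
      simp only [offsetClass, i1, i2, e0, h1, h2]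
  set c := (w + 1) * q with hc
  have hcq : q ≤ c := Nat.le_mul_of_pos_left _ (by omega)
  have hc3 : c ≤ 3 * q := Nat.mul_le_mul_right _ (by omega)
  set W := F.filter (fun p => c ≤ p.1 ∧ (p.1 - c) / (4 * q) < (p.2 - c) / (4 * q)) with hW
  -- The number of `l` with `c + s' + 4 q l < n`.
  set b := (n + 4 * q - 1 - c - s') / (4 * q) with hb
  have hlb : ∀ l, l < b ↔ c + s' + l * (4 * q) < n := by
    intro l
    rw [hb, ← Nat.succ_le_iff, Nat.le_div_iff_mul_le (by omega), Nat.succ_mul l]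
    omega
  have hbm : b ≤ m := by
    rw [hb, ← Nat.lt_succ_iff, Nat.div_lt_iff_lt_mul (by omega), Nat.succ_mul m]
    omega
  have hrest : F \ W ⊆ (nearPairs (4 * q) n).filter (fun p => offsetClass q p = (w, s, s')) := by
    intro p hp
    simp only [hW, hF, Finset.mem_sdiff, Finset.mem_filter, not_and, not_lt, and_imp] at hp
    obtain ⟨⟨hp1, hp2⟩, hp3⟩ := hp
    refine Finset.mem_filter.2 ⟨Finset.mem_filter.2 ⟨hp1, ?_⟩, hp2⟩
    by_cases hci : c ≤ p.1
    · right
      have hle := hp3 hp1 hp2 hci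
      have hp12 := (mem_pairs.1 hp1).1
      have e1 := eq_of_offset hw hci
      have e2 := eq_of_offset hw (hci.trans hp12.le)
      obtain ⟨o1, o2⟩ := (hcls p).1 hp2
      rw [o1, ← hc] at e1
      rw [o2, ← hc] at e2
      have := Nat.mul_le_mul_right (4 * q) hle
      omega
    · left; omega
  have hkl : ∀ (s k : ℕ), s < 3 * q → (c + s + k * (4 * q) - c) / (4 * q) = k := by
    intro s k hs
    rw [show c + s + k * (4 * q) - c = s + k * (4 * q) by omega,
      Nat.add_mul_div_right _ _ (by omega), Nat.div_eq_of_lt (by omega), zero_add]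
  have hWsum : ∑ p ∈ W, g p = ∑ l ∈ Finset.range b, ∑ k ∈ Finset.range l,
      g (c + s + k * (4 * q), c + s' + l * (4 * q)) := by
    rw [Finset.sum_sigma']
    refine Finset.sum_nbij' (fun p => ⟨(p.2 - c) / (4 * q), (p.1 - c) / (4 * q)⟩)
      (fun x => (c + s + x.2 * (4 * q), c + s' + x.1 * (4 * q))) ?_ ?_ ?_ ?_ ?_
    · intro p hp
      simp only [hW, hF, Finset.mem_filter] at hp
      obtain ⟨⟨hp1, hp2⟩, hci, hlt⟩ := hp
      obtain ⟨hp12, hpn⟩ := mem_pairs.1 hp1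
      simp only [Finset.mem_sigma, Finset.mem_range, hlb]
      have e2 := eq_of_offset hw (hci.trans hp12.le)
      rw [((hcls p).1 hp2).2, ← hc] at e2
      exact ⟨e2 ▸ hpn, hlt⟩
    · rintro ⟨l, k⟩ hx
      simp only [Finset.mem_sigma, Finset.mem_range, hlb] at hx
      obtain ⟨hx1, hx2⟩ := hx
      have hmul : (k + 1) * (4 * q) ≤ l * (4 * q) := Nat.mul_le_mul_right _ hx2
      rw [add_mul] at hmul
      refine Finset.mem_filter.2 ⟨Finset.mem_filter.2 ⟨mem_pairs.2 ⟨?_, hx1⟩, (hcls _).2 ⟨?_, ?_⟩⟩,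
        ?_, ?_⟩
      · simp only []; omega
      · exact offset_add hw hs
      · exact offset_add hw hs'
      · simp only []; omega
      · simp only [hkl s k hs, hkl s' l hs', hx2]
    · intro p hp
      simp only [hW, hF, Finset.mem_filter] at hp
      obtain ⟨⟨hp1, hp2⟩, hci, hlt⟩ := hp
      obtain ⟨o1, o2⟩ := (hcls p).1 hp2
      have e1 := eq_of_offset hw hci
      have e2 := eq_of_offset hw (hci.trans (mem_pairs.1 hp1).1.le)
      rw [o1] at e1
      rw [o2] at e2
      exact Prod.ext e1.symm e2.symm
    · rintro ⟨l, k⟩ hx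
      simp only [hkl s k hs, hkl s' l hs']
    · intro p hp
      simp only [hW, hF, Finset.mem_filter] at hp
      obtain ⟨⟨hp1, hp2⟩, hci, hlt⟩ := hp
      obtain ⟨o1, o2⟩ := (hcls p).1 hp2
      have e1 := eq_of_offset hw hci
      have e2 := eq_of_offset hw (hci.trans (mem_pairs.1 hp1).1.le)
      rw [o1] at e1
      rw [o2] at e2
      exact congrArg g (Prod.ext e1 e2)
  rw [← Finset.sum_sdiff (Finset.filter_subset _ F : W ⊆ F), hWsum]
  refine (enorm_add_le _ _).trans (add_le_add ?_ ?_)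
  · exact (enorm_sum_le _ _).trans (Finset.sum_le_sum_of_subset hrest)
  · exact le_iSup₂_of_le (f := fun b (_ : b ∈ Finset.range (m + 1)) =>
      ‖∑ l ∈ Finset.range b, ∑ k ∈ Finset.range l,
        g (c + s + k * (4 * q), c + s' + l * (4 * q))‖ₑ) b
      (by simpa using Nat.lt_succ_of_le hbm) le_rfl

/-- Splitting the pairs according to `offsetClass`. -/
theorem enorm_sum_pairs_le {H : Type*} [NormedAddCommGroup H] (g : ℕ × ℕ → H) {q m n : ℕ}
    (hq : 0 < q) (hn : n ≤ m * (4 * q)) :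
    ‖∑ p ∈ pairs n, g p‖ₑ ≤ ∑ p ∈ nearPairs (4 * q) n, ‖g p‖ₑ
      + ∑ w ∈ Finset.range 3, ∑ u ∈ Finset.range (3 * q) ×ˢ Finset.range (3 * q),
          ⨆ b ∈ Finset.range (m + 1), ‖∑ l ∈ Finset.range b, ∑ k ∈ Finset.range l,
            g ((w + 1) * q + u.1 + k * (4 * q), (w + 1) * q + u.2 + l * (4 * q))‖ₑ := by
  rw [← Finset.sum_fiberwise_of_maps_to (fun p _ => offsetClass_mem hq p) g,
    ← Finset.sum_fiberwise_of_maps_to (s := nearPairs (4 * q) n) (fun p _ => offsetClass_mem hq p)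
      (fun p => ‖g p‖ₑ),
    ← Finset.sum_product', ← Finset.sum_add_distrib]
  refine (enorm_sum_le _ _).trans (Finset.sum_le_sum fun x hx => ?_)
  simp only [Finset.mem_product, Finset.mem_range] at hx
  exact enorm_sum_offsetClass_le g hq hn hx.1 hx.2.1 hx.2.2

theorem blockSum_eq_sum_range {κ S H : Type*} [AddCommMonoid H] (h : S × S → H) (s s' : κ)
    {m b : ℕ} (hb : b ≤ m) (x : ℕ → κ → S) :
    blockSum h s s' b (fun k : Fin m => x k)
      = ∑ l ∈ Finset.range b, ∑ k ∈ Finset.range l, h (x k s, x l s') := by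
  have hconv : ∀ (b : ℕ), b ≤ m → ∀ (f : ℕ → H),
      ∑ l : Fin m with l.1 < b, f l.1 = ∑ l ∈ Finset.range b, f l := by
    intro b hb f
    rw [Finset.sum_filter, Fin.sum_univ_eq_sum_range (fun l => if l < b then f l else 0),
      ← Finset.sum_filter]
    congr 1
    ext l; simp only [Finset.mem_filter, Finset.mem_range]; omega
  rw [← hconv b hb]
  unfold blockSum
  refine Finset.sum_congr rfl fun l _ => ?_
  exact hconv l.1 l.2.le fun k => h (x k s, x l s')

/-- The indices of the `U`-statistic shifted by one, so that they start at `0`. -/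
theorem uStat_eq_sum_pairs {Ω S H : Type*} [AddCommMonoid H] (h : S × S → H) (X : ℤ → Ω → S)
    (n : ℕ) (ω : Ω) :
    uStat h X n ω = ∑ p ∈ pairs n, h (X ((p.1 + 1 : ℕ) : ℤ) ω, X ((p.2 + 1 : ℕ) : ℤ) ω) := by
  unfold uStat
  refine Finset.sum_nbij' (fun z => ((z.1 - 1).toNat, (z.2 - 1).toNat))
    (fun p => (((p.1 + 1 : ℕ) : ℤ), ((p.2 + 1 : ℕ) : ℤ))) ?_ ?_ ?_ ?_ ?_
  · intro z hz
    simp only [Finset.mem_filter, Finset.mem_product, Finset.mem_Icc] at hz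
    rw [mem_pairs]
    constructor <;> simp only [] <;> omega
  · intro p hp
    rw [mem_pairs] at hp
    simp only [Finset.mem_filter, Finset.mem_product, Finset.mem_Icc]
    omega
  · intro z hz
    simp only [Finset.mem_filter, Finset.mem_product, Finset.mem_Icc] at hz
    ext <;> simp only [] <;> omega
  · intro p _
    ext <;> simp
  · intro z hz
    simp only [Finset.mem_filter, Finset.mem_product, Finset.mem_Icc] at hz
    have h1 : (((z.1 - 1).toNat + 1 : ℕ) : ℤ) = z.1 := by omega
    have h2 : (((z.2 - 1).toNat + 1 : ℕ) : ℤ) = z.2 := by omega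
    simp only [h1, h2]

/-- Pathwise blocking bound, uniform in `n' ≤ n`: the `U`-statistic is bounded by the near pairs
and by the functional `blockMax` of three systems of separated blocks. -/
theorem enorm_uStat_le {Ω S H : Type*} [NormedAddCommGroup H] (h : S × S → H) (X : ℤ → Ω → S)
    {q m n n' : ℕ} (hq : 0 < q) (hn : n ≤ m * (4 * q)) (hn' : n' ≤ n) (ω : Ω) :
    ‖uStat h X n' ω‖ₑ
      ≤ ∑ p ∈ nearPairs (4 * q) n, ‖h (X ((p.1 + 1 : ℕ) : ℤ) ω, X ((p.2 + 1 : ℕ) : ℤ) ω)‖ₑ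
        + ∑ w ∈ Finset.range 3, blockMax h fun k : Fin m => block X q w k ω := by
  rw [uStat_eq_sum_pairs]
  refine (enorm_sum_pairs_le (fun p => h (X ((p.1 + 1 : ℕ) : ℤ) ω, X ((p.2 + 1 : ℕ) : ℤ) ω)) hq
    (hn'.trans hn)).trans (add_le_add ?_ ?_)
  · refine Finset.sum_le_sum_of_subset fun p hp => ?_
    simp only [nearPairs, Finset.mem_filter, mem_pairs] at hp ⊢
    exact ⟨⟨hp.1.1, hp.1.2.trans_le hn'⟩, hp.2⟩
  · refine Finset.sum_le_sum fun w _ => ?_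
    unfold blockMax
    rw [Fintype.sum_prod_type, Finset.sum_product,
      ← Fin.sum_univ_eq_sum_range (n := 3 * q)]
    refine Finset.sum_le_sum fun s _ => ?_
    rw [← Fin.sum_univ_eq_sum_range (n := 3 * q)]
    refine Finset.sum_le_sum fun s' _ => iSup₂_mono fun b hb => ?_
    rw [blockSum_eq_sum_range h s s' (by simpa [Nat.lt_succ_iff] using hb)
      (fun k => block X q w k ω)]
    rfl

/-! ### The deviation bound and its summability -/

theorem beta_antitone {Ω S : Type*} {m₀ : MeasurableSpace Ω} [MeasurableSpace S] (P : Measure Ω)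
    (X : ℤ → Ω → S) : Antitone (beta P X) := by
  intro k k' hk
  refine iSup₂_mono fun l _ => betaCoeff_mono P le_rfl ?_
  refine biSup_mono fun i hi => ?_
  rw [Set.mem_Ici] at hi ⊢
  omega

/-- A polynomially weighted sum of the mixing coefficients bounds each of them: by monotonicity,
each of the terms with `n ≤ k < 2 n` is at least `n ^ γ β(2 n)`. -/
theorem beta_two_mul_le {Ω S : Type*} {m₀ : MeasurableSpace Ω} [MeasurableSpace S]
    (P : Measure Ω) (X : ℤ → Ω → S) {γ : ℝ} (hγ : 0 ≤ γ) (n : ℕ) :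
    (n : ℝ≥0∞) * (n : ℝ≥0∞) ^ γ * beta P X (2 * n) ≤
      ∑' k : ℕ, ENNReal.ofReal (((k + 1 : ℕ) : ℝ) ^ γ) * beta P X (k + 1) := by
  calc (n : ℝ≥0∞) * (n : ℝ≥0∞) ^ γ * beta P X (2 * n)
      = ∑ k ∈ Finset.Ico n (2 * n), (n : ℝ≥0∞) ^ γ * beta P X (2 * n) := by
        rw [Finset.sum_const, Nat.card_Ico, nsmul_eq_mul, show 2 * n - n = n by omega, mul_assoc]
    _ ≤ ∑ k ∈ Finset.Ico n (2 * n), ENNReal.ofReal (((k + 1 : ℕ) : ℝ) ^ γ) * beta P X (k + 1) := by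
        refine Finset.sum_le_sum fun k hk => ?_
        rw [Finset.mem_Ico] at hk
        gcongr
        · rw [← ENNReal.ofReal_rpow_of_nonneg (by positivity) hγ, ENNReal.ofReal_natCast]
          gcongr
          omega
        · exact beta_antitone P X (by omega)
    _ ≤ _ := ENNReal.sum_le_tsum _

section

variable {Ω S H : Type*} [MeasurableSpace Ω] [MeasurableSpace S]
    [NormedAddCommGroup H] [InnerProductSpace ℝ H] [CompleteSpace H] [MeasurableSpace H]
    [BorelSpace H] [SecondCountableTopology H] {P : Measure Ω} [IsProbabilityMeasure P]
    {X : ℤ → Ω → S} {h : S × S → H}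

omit [InnerProductSpace ℝ H] [CompleteSpace H] [SecondCountableTopology H]
  [IsProbabilityMeasure P] in
theorem lintegral_nearPairs_le (hX : ∀ i, Measurable (X i)) (hstat : StrictlyStationary P X)
    (hh : Measurable h) (L n : ℕ) :
    ∫⁻ ω, ∑ p ∈ nearPairs L n, ‖h (X ((p.1 + 1 : ℕ) : ℤ) ω, X ((p.2 + 1 : ℕ) : ℤ) ω)‖ₑ ∂P
      ≤ 2 * (n * L) * ⨆ (j : ℤ) (_ : 2 ≤ j), ∫⁻ ω, ‖h (X 1 ω, X j ω)‖ₑ ∂P := by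
  have hm : ∀ p : ℕ × ℕ, Measurable fun ω =>
      ‖h (X ((p.1 + 1 : ℕ) : ℤ) ω, X ((p.2 + 1 : ℕ) : ℤ) ω)‖ₑ := fun p =>
    (hh.comp ((hX _).prodMk (hX _))).enorm
  rw [lintegral_finsetSum _ fun p _ => hm p]
  refine (Finset.sum_le_card_nsmul _ _
    (⨆ (j : ℤ) (_ : 2 ≤ j), ∫⁻ ω, ‖h (X 1 ω, X j ω)‖ₑ ∂P) fun p hp => ?_).trans ?_
  · have hlt := (mem_pairs.1 (Finset.mem_filter.1 hp).1).1
    have hid := ((hstat.identDistrib_pair ((p.1 + 1 : ℕ) : ℤ) ((p.2 + 1 : ℕ) : ℤ)).comp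
      hh.enorm).lintegral_eq
    refine hid.trans_le ?_
    exact le_iSup₂_of_le (f := fun (j : ℤ) (_ : 2 ≤ j) => ∫⁻ ω, ‖h (X 1 ω, X j ω)‖ₑ ∂P) _
      (by push_cast; omega) le_rfl
  · rw [nsmul_eq_mul]
    gcongr
    exact_mod_cast card_nearPairs_le L n

/-- Deviation bound for the maximum of the `U`-statistics up to `n`, with blocks of period `4 q`.
The first term stems from the near pairs and the second from the three systems of blocks. -/
theorem measure_exists_uStat_gt_le (hX : ∀ i, Measurable (X i)) (hstat : StrictlyStationary P X)
    (hh : Measurable h) {r : ℝ} (hr1 : 1 ≤ r) (hr2 : r ≤ 2)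
    (hleft : ∀ᵐ v ∂P.map (X 1), ∫ u, h (u, v) ∂P.map (X 1) = 0)
    (hright : ∀ᵐ u ∂P.map (X 1), ∫ v, h (u, v) ∂P.map (X 1) = 0)
    (hint : Integrable h ((P.map (X 1)).prod (P.map (X 1)))) {q d n : ℕ} (hq : 0 < q)
    (hn : n ≤ 2 ^ d * (4 * q)) {t : ℝ≥0∞} (ht0 : t ≠ 0) (ht : t ≠ ∞) :
    P {ω | ∃ n' ≤ n, 4 * t < ‖uStat h X n' ω‖ₑ} ≤
      2 * (n * ((4 * q : ℕ) : ℝ≥0∞)) * (⨆ (j : ℤ) (_ : 2 ≤ j), ∫⁻ ω, ‖h (X 1 ω, X j ω)‖ₑ ∂P) / t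
      + 3 * ((((3 * q : ℕ) : ℝ≥0∞) ^ 2) ^ r * (4 * ((2 ^ d : ℕ) : ℝ≥0∞) ^ 2 *
          ((d + 1 : ℕ) : ℝ≥0∞) ^ r *
          ∫⁻ z, ‖h z‖ₑ ^ r ∂(P.map (X 1)).prod (P.map (X 1))) / t ^ r
        + 2 * ((2 ^ d : ℕ) : ℝ≥0∞) * beta P X q) := by
  set N : Ω → ℝ≥0∞ := fun ω => ∑ p ∈ nearPairs (4 * q) n,
    ‖h (X ((p.1 + 1 : ℕ) : ℤ) ω, X ((p.2 + 1 : ℕ) : ℤ) ω)‖ₑ with hN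
  have hNm : Measurable N :=
    Finset.measurable_sum _ fun p _ => (hh.comp ((hX _).prodMk (hX _))).enorm
  have hsub : {ω | ∃ n' ≤ n, 4 * t < ‖uStat h X n' ω‖ₑ} ⊆ {ω | t ≤ N ω} ∪
      ⋃ w ∈ Finset.range 3, {ω | t < blockMax h fun k : Fin (2 ^ d) => block X q w k ω} := by
    rintro ω ⟨n', hn', hlt⟩
    by_contra hcon
    simp only [Set.mem_union, Set.mem_iUnion, Set.mem_ofPred_eq, not_or, not_exists, not_le,
      not_lt] at hcon
    refine absurd (hlt.trans_le (enorm_uStat_le h X hq hn hn' ω)) (not_lt.2 ?_)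
    calc N ω + ∑ w ∈ Finset.range 3, blockMax h (fun k : Fin (2 ^ d) => block X q w k ω)
        ≤ t + ∑ w ∈ Finset.range 3, t :=
          add_le_add hcon.1.le (Finset.sum_le_sum fun w hw => hcon.2 w hw)
      _ = 4 * t := by
          rw [Finset.sum_const, Finset.card_range, nsmul_eq_mul]
          push_cast
          ring
  refine (measure_mono hsub).trans ((measure_union_le _ _).trans (add_le_add ?_ ?_))
  · exact (meas_ge_le_lintegral_div hNm.aemeasurable ht0 ht).trans
      (ENNReal.div_le_div_right (lintegral_nearPairs_le hX hstat hh _ _) _)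
  · refine (measure_biUnion_finset_le _ _).trans ((Finset.sum_le_card_nsmul _ _ _ fun w _ =>
      measure_blockMax_gt_le hX hstat hh hr1 hr2 hleft hright hint q w d ht0 ht).trans_eq ?_)
    rw [Finset.card_range, nsmul_eq_mul]
    norm_num

end

/-- The choice of the exponents: blocks of length about `n ^ a` and the threshold `n ^ κ` with
`κ < 2 / p`. With `r = p + δ`, the three terms of the deviation bound are at most `n ^ (-x)` up to
constants and logarithms. Such an `a` exists because `1 / (2 + γ) < δ / (p (r - 1))` for
`γ = p - 1 + p (p - 1) / δ`, which amounts to `0 < δ`. -/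
theorem exists_exponents {p δ : ℝ} (hp1 : 1 < p) (hδ : 0 < δ) (hpδ : p + δ < 2) :
    ∃ a κ x : ℝ, 0 < a ∧ a < 1 ∧ 0 < κ ∧ κ < 2 / p ∧ 0 < x ∧ 1 + a - κ ≤ -x ∧
      2 * a * (p + δ - 1) + 2 - (p + δ) * κ ≤ -x ∧
      1 - a * (2 + (p - 1 + p * (p - 1) / δ)) ≤ -x := by
  have hγ : 0 < 2 + (p - 1 + p * (p - 1) / δ) := by
    have : 0 < p * (p - 1) / δ := by
      apply div_pos _ hδ; nlinarith
    linarith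
  have hr : 0 < p + δ - 1 := by linarith
  obtain ⟨a, ha1, ha2⟩ : ∃ a, 1 / (2 + (p - 1 + p * (p - 1) / δ)) < a ∧
      a < δ / (p * (p + δ - 1)) := by
    apply exists_between
    rw [div_lt_div_iff₀ hγ (by positivity)]
    have : δ * (2 + (p - 1 + p * (p - 1) / δ)) = δ + p * δ + p * (p - 1) := by
      field_simp; ring
    rw [this]; nlinarith
  have ha0 : 0 < a := lt_trans (by positivity) ha1
  rw [div_lt_iff₀ hγ] at ha1
  rw [lt_div_iff₀ (by positivity)] at ha2
  have hap : a * p < 2 - p := by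
    have h1 : δ < (2 - p) * (p + δ - 1) := by nlinarith [mul_pos (sub_pos.2 hp1) (sub_pos.2 hpδ)]
    have : (a * p) * (p + δ - 1) < (2 - p) * (p + δ - 1) := by nlinarith
    exact lt_of_mul_lt_mul_right this hr.le
  have ha : a < 1 := by nlinarith
  obtain ⟨κ, hκ1, hκ2⟩ : ∃ κ, max (1 + a) ((2 * a * (p + δ - 1) + 2) / (p + δ)) < κ ∧
      κ < 2 / p := by
    apply exists_between
    apply max_lt
    · rw [lt_div_iff₀ (by linarith)]; nlinarith
    · rw [div_lt_div_iff₀ (by linarith) (by linarith)]; nlinarith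
  obtain ⟨hκ3, hκ4⟩ := max_lt_iff.1 hκ1
  rw [div_lt_iff₀ (by linarith)] at hκ4
  refine ⟨a, κ, min (κ - (1 + a)) (min (κ * (p + δ) - (2 * a * (p + δ - 1) + 2))
    (a * (2 + (p - 1 + p * (p - 1) / δ)) - 1)), ha0, ha, by linarith, hκ2, ?_, ?_, ?_, ?_⟩
  · refine lt_min (by linarith) (lt_min (by linarith) (by linarith))
  · have := min_le_left (κ - (1 + a)) (min (κ * (p + δ) - (2 * a * (p + δ - 1) + 2))
      (a * (2 + (p - 1 + p * (p - 1) / δ)) - 1))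
    linarith
  · have := (min_le_right (κ - (1 + a)) _).trans (min_le_left
      (κ * (p + δ) - (2 * a * (p + δ - 1) + 2)) (a * (2 + (p - 1 + p * (p - 1) / δ)) - 1))
    linarith
  · have := (min_le_right (κ - (1 + a)) _).trans (min_le_right
      (κ * (p + δ) - (2 * a * (p + δ - 1) + 2)) (a * (2 + (p - 1 + p * (p - 1) / δ)) - 1))
    linarith

theorem two_rpow_mul (y z : ℝ) : (2 : ℝ≥0∞) ^ y * 2 ^ z = 2 ^ (y + z) :=
  (ENNReal.rpow_add y z (by simp) (by simp)).symm

/-- The bound of `measure_exists_uStat_gt_le` with `n = 2 ^ N`, `q = 2 ^ (e + 1)` where `e` is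
`a N` rounded up, and `t = 2 ^ (κ N)`, simplified. -/
theorem scale_terms_le {a κ x r γ : ℝ} (hx1 : 1 + a - κ ≤ -x)
    (hx2 : 2 * a * (r - 1) + 2 - r * κ ≤ -x) (hx3 : 1 - a * (2 + γ) ≤ -x) (hγ : 0 ≤ γ)
    (hr1 : 1 ≤ r) (hr2 : r ≤ 2) {N e d : ℕ} (he1 : a * N ≤ e) (he2 : e ≤ a * N + 1)
    (hd : d + e + 3 = N) {C₁ C₂ C₃ b : ℝ≥0∞}
    (hb : ((2 ^ e : ℕ) : ℝ≥0∞) * ((2 ^ e : ℕ) : ℝ≥0∞) ^ γ * b ≤ C₃) :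
    2 * (((2 ^ N : ℕ) : ℝ≥0∞) * ((4 * 2 ^ (e + 1) : ℕ) : ℝ≥0∞)) * C₁ / 2 ^ (κ * N)
      + 3 * ((((3 * 2 ^ (e + 1) : ℕ) : ℝ≥0∞) ^ 2) ^ r * (4 * ((2 ^ d : ℕ) : ℝ≥0∞) ^ 2 *
          ((d + 1 : ℕ) : ℝ≥0∞) ^ r * C₂) / ((2 : ℝ≥0∞) ^ (κ * N)) ^ r
        + 2 * ((2 ^ d : ℕ) : ℝ≥0∞) * b)
      ≤ (2 ^ (5 : ℝ) * C₁ + 3 * (2 ^ (10 : ℝ) * C₂ + 2 * C₃)) *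
        (((N + 1 : ℕ) : ℝ≥0∞) ^ 2 * 2 ^ (-x * N)) := by
  have hN0 : (0 : ℝ) ≤ N := Nat.cast_nonneg N
  have hdR : (d : ℝ) + e + 3 = N := by exact_mod_cast hd
  have hpow : ∀ k : ℕ, ((2 ^ k : ℕ) : ℝ≥0∞) = 2 ^ (k : ℝ) := fun k => by
    rw [ENNReal.rpow_natCast]; push_cast; rfl
  have htwo : ∀ {y z : ℝ}, y ≤ z → (2 : ℝ≥0∞) ^ y ≤ 2 ^ z := fun hyz =>
    ENNReal.rpow_le_rpow_of_exponent_le (by norm_num) hyz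
  have hN1 : (1 : ℝ≥0∞) ≤ ((N + 1 : ℕ) : ℝ≥0∞) := by exact_mod_cast Nat.succ_pos N
  have hNsq : (1 : ℝ≥0∞) ≤ ((N + 1 : ℕ) : ℝ≥0∞) ^ 2 := one_le_pow₀ hN1
  set G := ((N + 1 : ℕ) : ℝ≥0∞) ^ 2 * 2 ^ (-x * N) with hG
  have hle : (2 : ℝ≥0∞) ^ (-x * N) ≤ G := le_mul_of_one_le_left (by positivity) hNsq
  have T1 : 2 * (((2 ^ N : ℕ) : ℝ≥0∞) * ((4 * 2 ^ (e + 1) : ℕ) : ℝ≥0∞)) * C₁ / 2 ^ (κ * N)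
      ≤ 2 ^ (5 : ℝ) * C₁ * G := by
    have e1 : ((4 * 2 ^ (e + 1) : ℕ) : ℝ≥0∞) = 2 ^ ((e : ℝ) + 3) := by
      rw [show 4 * 2 ^ (e + 1) = 2 ^ (e + 3) by ring, hpow]; push_cast; rfl
    rw [e1, hpow, div_eq_mul_inv, ← ENNReal.rpow_neg]
    calc 2 * ((2 : ℝ≥0∞) ^ (N : ℝ) * 2 ^ ((e : ℝ) + 3)) * C₁ * 2 ^ (-(κ * N))
        = (2 ^ (1 : ℝ) * (2 ^ (N : ℝ) * 2 ^ ((e : ℝ) + 3)) * 2 ^ (-(κ * N))) * C₁ := by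
          rw [ENNReal.rpow_one]; ring
      _ = 2 ^ (1 + (N + ((e : ℝ) + 3)) + -(κ * N)) * C₁ := by
          rw [two_rpow_mul, two_rpow_mul, two_rpow_mul]
      _ ≤ 2 ^ (5 + -x * N) * C₁ := by
          gcongr ?_ * _
          apply htwo; nlinarith
      _ = 2 ^ (5 : ℝ) * C₁ * 2 ^ (-x * N) := by rw [← two_rpow_mul]; ring
      _ ≤ _ := by gcongr
  have T2 : (((3 * 2 ^ (e + 1) : ℕ) : ℝ≥0∞) ^ 2) ^ r * (4 * ((2 ^ d : ℕ) : ℝ≥0∞) ^ 2 *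
          ((d + 1 : ℕ) : ℝ≥0∞) ^ r * C₂) / ((2 : ℝ≥0∞) ^ (κ * N)) ^ r
      ≤ 2 ^ (10 : ℝ) * C₂ * G := by
    have e1 : (((3 * 2 ^ (e + 1) : ℕ) : ℝ≥0∞) ^ 2) ^ r ≤ 2 ^ (2 * ((e : ℝ) + 3) * r) := by
      have : (((3 * 2 ^ (e + 1) : ℕ) : ℝ≥0∞)) ≤ 2 ^ ((e : ℝ) + 3) := by
        calc (((3 * 2 ^ (e + 1) : ℕ) : ℝ≥0∞)) ≤ ((2 ^ (e + 3) : ℕ) : ℝ≥0∞) := by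
              exact_mod_cast (by rw [pow_succ 2 (e + 2), pow_succ 2 (e + 1)]; omega)
          _ = _ := by rw [hpow]; push_cast; rfl
      calc (((3 * 2 ^ (e + 1) : ℕ) : ℝ≥0∞) ^ 2) ^ r ≤ ((2 ^ ((e : ℝ) + 3)) ^ 2) ^ r := by gcongr
        _ = _ := by
          rw [← ENNReal.rpow_natCast, ← ENNReal.rpow_mul, ← ENNReal.rpow_mul]
          congr 1; push_cast; ring
    have e2 : ((d + 1 : ℕ) : ℝ≥0∞) ^ r ≤ ((N + 1 : ℕ) : ℝ≥0∞) ^ 2 := by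
      rw [← ENNReal.rpow_natCast]
      calc ((d + 1 : ℕ) : ℝ≥0∞) ^ r ≤ ((N + 1 : ℕ) : ℝ≥0∞) ^ r := by
            gcongr; omega
        _ ≤ _ := ENNReal.rpow_le_rpow_of_exponent_le hN1 (by simpa using hr2)
    have e3 : (4 : ℝ≥0∞) * ((2 ^ d : ℕ) : ℝ≥0∞) ^ 2 = 2 ^ (2 + 2 * (d : ℝ)) := by
      rw [show (4 : ℝ≥0∞) * ((2 ^ d : ℕ) : ℝ≥0∞) ^ 2 = ((2 ^ (2 + 2 * d) : ℕ) : ℝ≥0∞) by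
        push_cast; ring, hpow]
      push_cast; rfl
    rw [div_eq_mul_inv, ← ENNReal.rpow_mul, ← ENNReal.rpow_neg, e3]
    calc _ ≤ 2 ^ (2 * ((e : ℝ) + 3) * r) * (2 ^ (2 + 2 * (d : ℝ)) * ((N + 1 : ℕ) : ℝ≥0∞) ^ 2 * C₂)
            * 2 ^ (-(κ * N * r)) := by gcongr
      _ = (2 ^ (2 * ((e : ℝ) + 3) * r) * 2 ^ (2 + 2 * (d : ℝ)) * 2 ^ (-(κ * N * r))) *
            (((N + 1 : ℕ) : ℝ≥0∞) ^ 2 * C₂) := by ring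
      _ = 2 ^ (2 * ((e : ℝ) + 3) * r + (2 + 2 * (d : ℝ)) + -(κ * N * r)) *
            (((N + 1 : ℕ) : ℝ≥0∞) ^ 2 * C₂) := by rw [two_rpow_mul, two_rpow_mul]
      _ ≤ 2 ^ (10 + -x * N) * (((N + 1 : ℕ) : ℝ≥0∞) ^ 2 * C₂) := by
          gcongr ?_ * _
          apply htwo
          have h1 := mul_le_mul_of_nonneg_right he2 (sub_nonneg.2 hr1)
          have h2 := mul_le_mul_of_nonneg_right hx2 hN0
          have hd' : (d : ℝ) = N - e - 3 := by linarith
          rw [hd']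
          nlinarith
      _ = 2 ^ (10 : ℝ) * C₂ * G := by rw [← two_rpow_mul, hG]; ring
  have T3 : 2 * ((2 ^ d : ℕ) : ℝ≥0∞) * b ≤ 2 * C₃ * G := by
    have hb' : b ≤ 2 ^ (-((e : ℝ) * (1 + γ))) * C₃ := by
      rw [hpow, ← ENNReal.rpow_mul, two_rpow_mul] at hb
      calc b = 2 ^ (-((e : ℝ) * (1 + γ))) * (2 ^ ((e : ℝ) + e * γ) * b) := by
            rw [← mul_assoc, two_rpow_mul]
            rw [show -((e : ℝ) * (1 + γ)) + (e + e * γ) = 0 by ring]; simp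
        _ ≤ _ := by gcongr
    rw [hpow]
    calc 2 * (2 : ℝ≥0∞) ^ (d : ℝ) * b ≤ 2 * 2 ^ (d : ℝ) * (2 ^ (-((e : ℝ) * (1 + γ))) * C₃) := by
          gcongr
      _ = 2 * C₃ * (2 ^ (d : ℝ) * 2 ^ (-((e : ℝ) * (1 + γ)))) := by ring
      _ = 2 * C₃ * 2 ^ ((d : ℝ) + -((e : ℝ) * (1 + γ))) := by rw [two_rpow_mul]
      _ ≤ 2 * C₃ * 2 ^ (-x * N) := by
          gcongr _ * ?_
          apply htwo
          have h1 := mul_le_mul_of_nonneg_right he1 (show 0 ≤ 2 + γ by linarith)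
          have h2 := mul_le_mul_of_nonneg_right hx3 hN0
          nlinarith
      _ ≤ _ := by gcongr
  calc _ ≤ 2 ^ (5 : ℝ) * C₁ * G + 3 * (2 ^ (10 : ℝ) * C₂ * G + 2 * C₃ * G) := by gcongr
    _ = _ := by ring

theorem tsum_sq_mul_two_rpow_ne_top {x : ℝ} (hx : 0 < x) :
    ∑' N : ℕ, ((N + 1 : ℕ) : ℝ≥0∞) ^ 2 * (2 : ℝ≥0∞) ^ (-x * N) ≠ ∞ := by
  have hlt : ‖(2 : ℝ) ^ (-x)‖ < 1 := by
    rw [Real.norm_of_nonneg (by positivity)]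
    exact Real.rpow_lt_one_of_one_lt_of_neg (by norm_num) (by linarith)
  have hs : Summable fun N : ℕ => ((N + 1 : ℕ) : ℝ) ^ 2 * ((2 : ℝ) ^ (-x)) ^ N := by
    have h0 := summable_pow_mul_geometric_of_norm_lt_one 0 hlt
    have h1 := summable_pow_mul_geometric_of_norm_lt_one 1 hlt
    have h2 := summable_pow_mul_geometric_of_norm_lt_one 2 hlt
    refine ((h2.add (h1.mul_left 2)).add h0).congr fun N => ?_
    push_cast; ring
  convert hs.tsum_ofReal_ne_top using 3 with N
  rw [ENNReal.ofReal_mul (by positivity), ENNReal.ofReal_pow (by positivity),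
    ENNReal.ofReal_natCast, ← Real.rpow_mul_natCast (by norm_num),
    ← ENNReal.ofReal_rpow_of_pos (by norm_num)]
  simp

/-! ### The strong law -/

/-- Interpolation between powers of two. -/
theorem tendsto_of_dyadic_bound {κ τ : ℝ} (hκ0 : 0 < κ) (hκ : κ < τ) {f : ℕ → ℝ}
    (hf0 : ∀ n, 0 ≤ f n) (hf : ∀ᶠ N : ℕ in atTop, ∀ n ≤ 2 ^ N, f n ≤ 4 * 2 ^ (κ * N)) :
    Tendsto (fun n : ℕ => 1 / (n : ℝ) ^ τ * f n) atTop (𝓝 0) := by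
  obtain ⟨N₀, hN₀⟩ := eventually_atTop.1 hf
  have hlim : Tendsto (fun n : ℕ => 4 * 2 ^ κ * (n : ℝ) ^ (-(τ - κ))) atTop (𝓝 0) := by
    have := ((tendsto_rpow_neg_atTop (sub_pos.2 hκ)).comp
      tendsto_natCast_atTop_atTop).const_mul (4 * 2 ^ κ)
    simpa [Function.comp_def] using this
  refine squeeze_zero' (Eventually.of_forall fun n => mul_nonneg (by positivity) (hf0 n)) ?_ hlim
  filter_upwards [eventually_ge_atTop (2 ^ N₀ + 1)] with n hn
  have hn1 : 1 < n := lt_of_lt_of_le (by have := Nat.one_le_two_pow (n := N₀); omega) hn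
  have hnpos : (0 : ℝ) < n := by exact_mod_cast (by omega : 0 < n)
  set N := Nat.clog 2 n with hN
  have h1 : n ≤ 2 ^ N := Nat.le_pow_clog (by norm_num) n
  have hNpos : 0 < N := Nat.clog_pos (by norm_num) hn1
  have h2 : 2 ^ (N - 1) < n := Nat.pow_pred_clog_lt_self (by norm_num) hn1
  have hNN : N₀ ≤ N := by
    by_contra hlt
    have : 2 ^ N ≤ 2 ^ N₀ := Nat.pow_le_pow_right (by norm_num) (by omega)
    omega
  have h3 : (2 : ℝ) ^ N ≤ 2 * n := by
    have : 2 ^ N ≤ 2 * n := by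
      rw [show N = N - 1 + 1 by omega, pow_succ]; omega
    exact_mod_cast this
  have h4 : f n ≤ 4 * (2 ^ κ * (n : ℝ) ^ κ) := by
    refine (hN₀ N hNN n h1).trans ?_
    gcongr
    rw [mul_comm κ, Real.rpow_mul (by norm_num), Real.rpow_natCast,
      ← Real.mul_rpow (by norm_num) hnpos.le]
    exact Real.rpow_le_rpow (by positivity) h3 hκ0.le
  calc 1 / (n : ℝ) ^ τ * f n ≤ 1 / (n : ℝ) ^ τ * (4 * (2 ^ κ * (n : ℝ) ^ κ)) := by gcongr
    _ = 4 * 2 ^ κ * (n : ℝ) ^ (-(τ - κ)) := by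
      rw [neg_sub, Real.rpow_sub hnpos]; ring

end MixingUStat

open MixingUStat in
theorem theorem5 {Ω S H : Type*} [MeasurableSpace Ω] (P : Measure Ω) [IsProbabilityMeasure P]
    [MetricSpace S] [TopologicalSpace.SeparableSpace S] [MeasurableSpace S] [BorelSpace S]
    [NormedAddCommGroup H] [InnerProductSpace ℝ H] [CompleteSpace H]
    [TopologicalSpace.SeparableSpace H] [MeasurableSpace H] [BorelSpace H]
    (X : ℤ → Ω → S) (hX : ∀ i, Measurable (X i))
    (hstat : MixingUStat.StrictlyStationary P X)
    (h : S × S → H) (hh : Measurable h)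
    (hdeg : MixingUStat.IsDegenerate P h (X 1))
    (p δ : ℝ) (hp1 : 1 < p) (hp2 : p < 2) (hδ : 0 < δ) (hpδ : p + δ < 2)
    (hmoment : (∫⁻ w, ‖MixingUStat.copyPair h (X 1) w‖ₑ ^ (p + δ) ∂(P.prod P)) < ∞)
    (hL1 : (⨆ (j : ℤ) (_ : 2 ≤ j), ∫⁻ ω, ‖h (X 1 ω, X j ω)‖ₑ ∂P) < ∞)
    (hmix : (∑' k : ℕ, ENNReal.ofReal (((k + 1 : ℕ) : ℝ) ^ (p - 1 + p * (p - 1) / δ)) *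
      MixingUStat.beta P X (k + 1)) < ∞) :
    ∀ᵐ ω ∂P, Tendsto
      (fun n : ℕ => 1 / (n : ℝ) ^ (2 / p) * ‖MixingUStat.uStat h X n ω‖) atTop (𝓝 0) := by
  have : SecondCountableTopology H := UniformSpace.secondCountable_of_separable H
  have : IsProbabilityMeasure (P.map (X 1)) := Measure.isProbabilityMeasure_map (hX 1).aemeasurable
  set r := p + δ with hr
  set γ := p - 1 + p * (p - 1) / δ with hγ
  have hγ0 : 0 ≤ γ := by
    have : 0 ≤ p * (p - 1) / δ := div_nonneg (by nlinarith) hδ.le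
    linarith
  have hC₂ : ∫⁻ z, ‖h z‖ₑ ^ r ∂(P.map (X 1)).prod (P.map (X 1)) < ∞ := by
    rw [← (measurePreserving_prodMap (hX 1)).lintegral_comp (by fun_prop)]
    exact hmoment
  have hint : Integrable h ((P.map (X 1)).prod (P.map (X 1))) :=
    integrable_of_lintegral_rpow_lt_top hh.aestronglyMeasurable (by linarith) hC₂
  obtain ⟨hleft, hright⟩ := hdeg.ae_integral_eq_zero (hX 1) hint
  obtain ⟨a, κ, x, ha0, ha1, hκ0, hκ, hx0, hx1, hx2, hx3⟩ := exists_exponents hp1 hδ hpδ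
  set C := (2 : ℝ≥0∞) ^ (5 : ℝ) * (⨆ (j : ℤ) (_ : 2 ≤ j), ∫⁻ ω, ‖h (X 1 ω, X j ω)‖ₑ ∂P)
    + 3 * (2 ^ (10 : ℝ) * ∫⁻ z, ‖h z‖ₑ ^ r ∂(P.map (X 1)).prod (P.map (X 1))
      + 2 * ∑' k : ℕ, ENNReal.ofReal (((k + 1 : ℕ) : ℝ) ^ γ) * beta P X (k + 1)) with hC
  have hCfin : C ≠ ∞ := by
    have h5 : ∀ y : ℝ, 0 ≤ y → (2 : ℝ≥0∞) ^ y ≠ ∞ := fun y hy =>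
      ENNReal.rpow_ne_top_of_nonneg hy (by simp)
    refine ENNReal.add_ne_top.2 ⟨ENNReal.mul_ne_top (h5 _ (by norm_num)) hL1.ne,
      ENNReal.mul_ne_top (by simp) (ENNReal.add_ne_top.2
        ⟨ENNReal.mul_ne_top (h5 _ (by norm_num)) hC₂.ne, ENNReal.mul_ne_top (by simp) hmix.ne⟩)⟩
  set A : ℕ → Set Ω := fun N => {ω | ∃ n ≤ 2 ^ N, 4 * (2 : ℝ≥0∞) ^ (κ * N) < ‖uStat h X n ω‖ₑ}
    with hA
  -- The period `2 ^ (e + 3)` of the blocks is at most `2 ^ N` only for large `N`, as `a < 1`.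
  obtain ⟨N₀, hN₀⟩ := exists_nat_ge (4 / (1 - a))
  have hbound : ∀ N : ℕ, N₀ ≤ N →
      P (A N) ≤ C * (((N + 1 : ℕ) : ℝ≥0∞) ^ 2 * 2 ^ (-x * N)) := by
    intro N hN
    set e := ⌈a * N⌉₊ with he
    have he1 : a * N ≤ e := Nat.le_ceil _
    have he2 : (e : ℝ) ≤ a * N + 1 := (Nat.ceil_lt_add_one (by positivity)).le
    have heN : e + 3 ≤ N := by
      have h1 : 4 / (1 - a) ≤ N := hN₀.trans (by exact_mod_cast hN)
      rw [div_le_iff₀ (by linarith)] at h1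
      have : (e : ℝ) + 3 ≤ N := by linarith
      exact_mod_cast this
    obtain ⟨d, hd⟩ : ∃ d, d + e + 3 = N := ⟨N - e - 3, by omega⟩
    have hsize : 2 ^ N ≤ 2 ^ d * (4 * 2 ^ (e + 1)) := by
      rw [← hd]; exact le_of_eq (by ring)
    refine (measure_exists_uStat_gt_le hX hstat hh (r := r) (by linarith) hpδ.le hleft hright hint
      (q := 2 ^ (e + 1)) (by positivity) hsize (t := 2 ^ (κ * N)) (by simp)
      (ENNReal.rpow_ne_top_of_nonneg (by positivity) (by simp))).trans ?_
    refine scale_terms_le hx1 hx2 hx3 hγ0 (by linarith) hpδ.le he1 he2 hd ?_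
    have := beta_two_mul_le P X hγ0 (2 ^ e)
    rwa [show 2 * 2 ^ e = 2 ^ (e + 1) by ring] at this
  have hsum : ∑' N, P (A (N + N₀)) ≠ ∞ := by
    refine ne_top_of_le_ne_top (ENNReal.mul_ne_top hCfin (tsum_sq_mul_two_rpow_ne_top hx0)) ?_
    rw [← ENNReal.tsum_mul_left]
    calc ∑' N, P (A (N + N₀))
        ≤ ∑' N : ℕ, C * (((N + N₀ + 1 : ℕ) : ℝ≥0∞) ^ 2 * 2 ^ (-x * ((N + N₀ : ℕ) : ℝ))) :=
          ENNReal.tsum_le_tsum fun N => hbound (N + N₀) (by omega)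
      _ ≤ _ := ENNReal.tsum_comp_le_tsum_of_injective (add_left_injective N₀)
          fun N : ℕ => C * (((N + 1 : ℕ) : ℝ≥0∞) ^ 2 * 2 ^ (-x * N))
  filter_upwards [ae_eventually_notMem hsum] with ω hω
  refine tendsto_of_dyadic_bound hκ0 hκ (fun n => norm_nonneg _) ?_
  obtain ⟨M, hM⟩ := eventually_atTop.1 hω
  refine eventually_atTop.2 ⟨M + N₀, fun N hN n hn => ?_⟩
  have hmem := hM (N - N₀) (by omega)
  rw [Nat.sub_add_cancel (by omega)] at hmem
  simp only [hA, Set.mem_ofPred_eq, not_exists, not_and, not_lt] at hmem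
  have h1 := hmem n hn
  have h2 : (4 : ℝ≥0∞) * 2 ^ (κ * (N : ℝ))
      = ENNReal.ofReal (4 * 2 ^ (κ * (N : ℝ))) := by
    rw [ENNReal.ofReal_mul (by norm_num), ← ENNReal.ofReal_rpow_of_pos (by norm_num)]
    simp
  rw [h2, ← ofReal_norm, ENNReal.ofReal_le_ofReal_iff (by positivity)] at h1
  exact h1
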